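/- **Notation.** Words and sequences are over $\{0,1\}$ and are compared lexicographically. For $\beta\in(1,2]$ put $\pi_\beta((c_i))=\sum_{i\ge1}c_i\beta^{-i}$ and $T_\beta(x)=\beta x \bmod 1$ on $[0,1)$. The greedy expansion $b(t,\beta)$ of $t\in[0,1)$ is the largest sequence $c$ with $\pi_\beta(c)=t$; the quasi-greedy expansion $\alpha(\beta)$ is the largest sequence $c$ not ending in $0^\infty$ with $\pi_\beta(c)=1$. Let $$K_\beta(t)=\{x\in[0,1):T_\beta^n(x)\ge t\ \ \forall n\ge0\},\qquad \tau(\beta)=\min\{t>0:\dim_H K_\beta(t)=0\},$$ $$\mathscr E_\beta=\{t\in[0,1):K_\beta(t')\ne K_\beta(t)\ \ \forall t'>t\}.$$ The ordered lists $F_n$ of words are given by $F_0=(0,1)$, with $F_{n+1}$ obtained from $F_n$ by inserting between any two neighbours $\mathbf v,\mathbf w$ their concatenation $\mathbf{vw}$; $F^*$ is the set of all words of length at least two occurring in some $F_n$ (Farey words). For a word $\mathbf s$ let $\mathbb L(\mathbf s)$ be its largest cyclic permutation, $\mathbf s^-$ (if $\mathbf s$ ends in $1$) the word with the last digit changed to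 $0$, and $\mathbf s^+$ (if $\mathbf s$ ends in $0$) the word with the last digit changed to $1$. For words $\mathbf s,\mathbf r$, the word $\mathbf s\bullet\mathbf r$ is obtained from $\mathbf r$ by replacing every maximal run $0^k$ by $\mathbf s^-\mathbb L(\mathbf s)^{k-1}$ and every maximal run $1^l$ by $\mathbb L(\mathbf s)^+\mathbf s^{l-1}$. Products are read from the left: $\mathbf s_1\bullet\cdots\bullet\mathbf s_{n+1}=(\mathbf s_1\bullet\cdots\bullet\mathbf s_n)\bullet\mathbf s_{n+1}$. Let $\Lambda_k=\{\mathbf s_1\bullet\cdots\bullet\mathbf s_k:\mathbf s_i\in F^*\}$. For $\mathbf S\in\Lambda_k$ let $J^{\mathbf S}=[\beta_\ell^{\mathbf S},\beta_r^{\mathbf S}]\subseteq(1,2]$, where $\alpha(\beta_\ell^{\mathbf S})=\mathbb L(\mathbf S)^\infty$ and $\alpha(\beta_r^{\mathbf S})=\mathbb L(\mathbf S)^+\mathbf S^\infty$. The set of infinitely renormalizable bases is $$E_\infty=\bigcap_{k\ge1}\ \bigcup_{\mathbf S\in\Lambda_k}J^{\mathbf S}.$$ **Proposition.** Let $\beta\in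 E_\infty$. There is a unique sequence $\mathbf s_1,\mathbf s_2,\dots$ in $F^*$ such that $\beta\in J^{\mathbf s_1\bullet\cdots\bullet\mathbf s_n}$ for all $n\ge1$. For this sequence, the minimum defining $\tau(\beta)$ exists and $$\tau(\beta)=\lim_{n\to\infty}\pi_\beta(\mathbf s_1\bullet\cdots\bullet\mathbf s_n0^\infty).$$ Moreover, $\mathscr E_\beta\cap(\tau(\beta),1)$ is countably infinite; it consists exactly of the points $t_1>t_2>t_3>\cdots$ whose greedy $\beta$-expansions are $$b(t_n,\beta)=(\mathbf s_1\bullet\cdots\bullet\mathbf s_n)^\infty,\qquad n=1,2,\dots.$$ -/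

import Mathlib

open Set Filter Topology

namespace BetaHole

/-- Finite words over the alphabet `{0,1}`; `false` is the digit `0` and `true` is the digit `1`. -/
abbrev Word := List Bool

/-- Infinite sequences `(c₁, c₂, …)` over `{0,1}`; the digit `c_{i+1}` is `c i`. -/
abbrev BinSeq := ℕ → Bool

/-! ### Expansions in base `β` -/

/-- The projection `π_β((c_i)) = ∑_{i ≥ 1} c_i β^{-i}`. -/
noncomputable def proj (β : ℝ) (c : BinSeq) : ℝ :=
  ∑' i : ℕ, (if c i then (1 : ℝ) else 0) / β ^ (i + 1)

/-- `c` is the greedy expansion `b(x, β)`: the lexicographically largest sequence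
with `π_β(c) = x`. -/
def IsGreedy (β x : ℝ) (c : BinSeq) : Prop :=
  proj β c = x ∧ ∀ d : BinSeq, proj β d = x → toLex d ≤ toLex c

/-- The sequence `c` does not end in `0^∞`. -/
def NotEndingInZeros (c : BinSeq) : Prop := ∀ N : ℕ, ∃ n ≥ N, c n = true

/-- `c` is the quasi-greedy expansion `α(β)` of `1`: the lexicographically largest sequence
with `π_β(c) = 1` among those that do not end in `0^∞`. -/
def IsQuasiGreedy (β : ℝ) (c : BinSeq) : Prop :=
  (proj β c = 1 ∧ NotEndingInZeros c) ∧
    ∀ d : BinSeq, proj β d = 1 → NotEndingInZeros d → toLex d ≤ toLex c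

/-! ### The open system and its bifurcation set -/

/-- The map `T_β(x) = βx mod 1`. -/
noncomputable def betaMap (β x : ℝ) : ℝ := Int.fract (β * x)

/-- The survivor set `K_β(t) = {x ∈ [0,1) : T_β^n(x) ≥ t for all n ≥ 0}`. -/
def survivor (β t : ℝ) : Set ℝ :=
  {x | x ∈ Ico (0 : ℝ) 1 ∧ ∀ n : ℕ, t ≤ (betaMap β)^[n] x}

/-- The bifurcation set `{t ∈ [0,1) : K_β(t') ≠ K_β(t) for all t' > t}`. -/
def bifurcationSet (β : ℝ) : Set ℝ :=
  {t | t ∈ Ico (0 : ℝ) 1 ∧ ∀ t' : ℝ, t < t' → survivor β t' ≠ survivor β t}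

/-- The holes `t > 0` whose survivor set has Hausdorff dimension zero. -/
def zeroDimHoles (β : ℝ) : Set ℝ :=
  {t | 0 < t ∧ dimH (survivor β t) = 0}

/-- The critical value `τ(β) = min {t > 0 : dim_H K_β(t) = 0}`. -/
noncomputable def tau (β : ℝ) : ℝ := sInf (zeroDimHoles β)

/-! ### Words -/

/-- The concatenation of a word and a sequence. -/
def appendSeq (w : Word) (c : BinSeq) : BinSeq :=
  fun i => if h : i < w.length then w[i] else c (i - w.length)

/-- The sequence `w0^∞`. -/
def withZeros (w : Word) : BinSeq := appendSeq w (fun _ => false)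

/-- The periodic sequence `w^∞` (for a nonempty word `w`). -/
def periodic (w : Word) : BinSeq := fun i => w.getD (i % w.length) false

/-- `w⁺`: the last digit of `w` is replaced by `1` (used when it is `0`). -/
def wordPlus (w : Word) : Word := w.dropLast ++ [true]

/-- `w⁻`: the last digit of `w` is replaced by `0` (used when it is `1`). -/
def wordMinus (w : Word) : Word := w.dropLast ++ [false]

/-- `𝕃(w)`: the lexicographically largest cyclic permutation of `w`
(the empty word is the smallest word, so it is harmless as the initial value). -/
def maxRotation (w : Word) : Word := w.cyclicPermutations.foldr max []

/-- Insert between any two neighbours of a list of words their concatenation. -/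
def fareyStep : List Word → List Word
  | [] => []
  | [w] => [w]
  | w :: v :: l => w :: (w ++ v) :: fareyStep (v :: l)

/-- The ordered sets `F_n` with `F_0 = (0, 1)`. -/
def fareyList (n : ℕ) : List Word := fareyStep^[n] [[false], [true]]

/-- `F*`: the Farey words of length at least two. -/
def fareyStar : Set Word :=
  {w | (∃ n : ℕ, w ∈ fareyList n) ∧ w ≠ [false] ∧ w ≠ [true]}

/-- The block of the substitution `Φ_s` that corresponds to a digit `cur` preceded by the
digit `prev`. -/
def block (s : Word) : (prev cur : Bool) → Word
  | true, false => wordMinus s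
  | false, false => maxRotation s
  | false, true => wordPlus (maxRotation s)
  | true, true => s

/-- The blocks of the digits of a word that is preceded by the digit `prev`. -/
def substAux (s : Word) : (prev : Bool) → Word → Word
  | _, [] => []
  | prev, d :: r => block s prev d ++ substAux s d r

/-- The substitution `s • r = Φ_s(r)` on finite words. A run `0^k` becomes `s⁻ 𝕃(s)^{k-1}` and a
run `1^l` becomes `𝕃(s)⁺ s^{l-1}`. The first digit of a word starts a run, so it is treated as if
it were preceded by the opposite digit. -/
def subst (s : Word) : Word → Word
  | [] => []
  | d :: r => substAux s (!d) (d :: r)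

/-- The words `S_n = s₁ • s₂ • ⋯ • s_n`, where `s_{i+1} = s i` and `S_{n+1} = bullet s n`. -/
def bullet (s : ℕ → Word) : ℕ → Word
  | 0 => s 0
  | n + 1 => subst (bullet s n) (s (n + 1))

/-- The set `Λ_{n+1}` of the words `s₁ • ⋯ • s_{n+1}` with all `s_i` in `F*`. -/
def lambdaSucc (n : ℕ) : Set Word :=
  {S | ∃ s : ℕ → Word, (∀ i, s i ∈ fareyStar) ∧ bullet s n = S}

/-- The Lyndon interval `J^S = [β_ℓ, β_r]` in `(1,2]`, where `α(β_ℓ) = 𝕃(S)^∞` and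
`α(β_r) = 𝕃(S)⁺ S^∞`. -/
def lyndonInterval (S : Word) : Set ℝ :=
  {β | ∃ βl ∈ Ioc (1 : ℝ) 2, ∃ βr ∈ Ioc (1 : ℝ) 2,
    IsQuasiGreedy βl (periodic (maxRotation S)) ∧
    IsQuasiGreedy βr (appendSeq (wordPlus (maxRotation S)) (periodic S)) ∧
    β ∈ Icc βl βr}

/-- The set `E_∞` of infinitely renormalizable bases: `⋂_{k ≥ 1} ⋃_{S ∈ Λ_k} J^S`. -/
def infRenormalizable : Set ℝ := ⋂ n : ℕ, ⋃ S ∈ lambdaSucc n, lyndonInterval S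

/-- `s₁, s₂, …` is a sequence of Farey words in `F*` that corresponds to `β`:
`β ∈ J^{s₁ • ⋯ • s_n}` for every `n ≥ 1`. -/
def IsFareySequence (β : ℝ) (s : ℕ → Word) : Prop :=
  (∀ i, s i ∈ fareyStar) ∧ ∀ n, β ∈ lyndonInterval (bullet s n)

end BetaHole

open BetaHole

/-! Everything is translated to sequences. Let A = α(β). The greedy expansions of the points of
[0,1) are the sequences whose tails are all below A (`QuasiGreedyTails.admissible_iff`), projection
preserves their order, and t in [0,1) is a bifurcation point exactly when no iterate of t falls
below t (`mem_bifurcationSet_iff`). The question becomes which sequences c satisfy c ≤ σ^k c < A for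
all k, where σ is the shift.

Write S_n for `bullet s n`. For β in the Lyndon interval of S_n, A lies between 𝕃(S_n)^∞ and
𝕃(S_n)⁺S_n^∞. Two facts then carry the proof. Rigidity: Farey words are Christoffel words, hence
balanced, so a sequence with all tails between s^∞ and 𝕃(s)^∞ is in the orbit of s^∞
(`eq_shift_mech`). Desubstitution: Φ_S preserves order, and a sequence with all tails between
S⁻𝕃(S)^∞ and 𝕃(S)⁺S^∞ is an image under Φ_S unless it lies strictly between S^∞ and 𝕃(S)^∞
(`LyndonPair.exists_inflate`). Alternating the two peels off one Farey word at a time.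

For A itself this yields the uniqueness of the Farey sequence (`eq_of_inLyndon_bullet`). For a c
that is smallest among its tails and above all S_n⁻𝕃(S_n)^∞, it shows that c ≤ S_n^∞ forces c =
S_n^∞ or c ≤ S_{n+1}^∞; so c is some S_m^∞ or lies below all of them
(`Renormalizable.eq_periodic_or_le`). The sequences S_n^∞ decrease, the sequences S_n⁻𝕃(S_n)^∞
increase, and for each n the two share |S_n| - 1 digits, so both families of projections have the
same limit, `limitPoint`. Above it the bifurcation points are exactly the projections of the S_m^∞.

The limit is also the critical value. At the limit every survivor is, after a finite prefix, some
S_m^∞ or an image under Φ_{S_n}, and these images have dimension O(1/|S_n|) for every n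
(`dimH_survivor_limitPoint`). Below the limit some S_n⁻𝕃(S_n)^∞ projects above t, and Φ_{S_n}
applied to sparse sequences with free digits gives a surviving set of positive dimension
(`dimH_survivor_ne_zero`). -/

namespace BetaHole

/-! ### The lexicographic order on sequences -/

/-- The sequence without its first `k` digits. -/
def shift (k : ℕ) (c : BinSeq) : BinSeq := fun i => c (i + k)

/-- The sequence `pc`. -/
def consSeq (p : Bool) (c : BinSeq) : BinSeq := fun i => if i = 0 then p else c (i - 1)

/-- The sequence with all digits changed. -/
def flip (c : BinSeq) : BinSeq := fun i => !c i

@[simp] lemma shift_apply (k : ℕ) (c : BinSeq) (i : ℕ) : shift k c i = c (i + k) := rfl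

@[simp] lemma flip_apply (c : BinSeq) (i : ℕ) : flip c i = !c i := rfl

@[simp] lemma consSeq_zero (p : Bool) (c : BinSeq) : consSeq p c 0 = p := rfl

@[simp] lemma consSeq_succ (p : Bool) (c : BinSeq) (i : ℕ) : consSeq p c (i + 1) = c i := rfl

lemma shift_shift (k l : ℕ) (c : BinSeq) : shift k (shift l c) = shift (l + k) c := by
  funext i; simp only [shift_apply]; congr 1; omega

@[simp] lemma flip_flip (c : BinSeq) : flip (flip c) = c := by funext i; simp

lemma shift_flip (k : ℕ) (c : BinSeq) : shift k (flip c) = flip (shift k c) := rfl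

@[simp] lemma shift_one_consSeq (p : Bool) (c : BinSeq) : shift 1 (consSeq p c) = c := rfl

lemma shift_succ_consSeq (p : Bool) (c : BinSeq) (k : ℕ) :
    shift (k + 1) (consSeq p c) = shift k c := rfl

lemma consSeq_shift_one (c : BinSeq) : consSeq (c 0) (shift 1 c) = c := by
  funext i; cases i <;> rfl

lemma consSeq_shift_succ (c : BinSeq) (k : ℕ) : consSeq (c k) (shift (k + 1) c) = shift k c := by
  funext i
  cases i
  · simp
  · simp only [consSeq_succ, shift_apply]; congr 1; omega

lemma lex_lt_iff {c d : BinSeq} :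
    toLex c < toLex d ↔ ∃ n, (∀ i < n, c i = d i) ∧ c n = false ∧ d n = true := by
  have : toLex c < toLex d ↔ ∃ n, (∀ i < n, c i = d i) ∧ c n < d n := Iff.rfl
  simp only [this, Bool.lt_iff]

lemma lex_not_lt {c d : BinSeq} : ¬ toLex c < toLex d ↔ toLex d ≤ toLex c := not_lt

lemma lex_not_le {c d : BinSeq} : ¬ toLex c ≤ toLex d ↔ toLex d < toLex c := not_le

lemma lex_lt_of_head {c d : BinSeq} (hc : c 0 = false) (hd : d 0 = true) : toLex c < toLex d :=
  lex_lt_iff.2 ⟨0, by simp, hc, hd⟩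

lemma exists_first_diff {c d : BinSeq} (h : c ≠ d) : ∃ n, (∀ i < n, c i = d i) ∧ c n ≠ d n := by
  have h' : ∃ n, c n ≠ d n := Function.ne_iff.1 h
  classical
  exact ⟨Nat.find h', fun i hi => not_not.1 (Nat.find_min h' hi), Nat.find_spec h'⟩

lemma lex_lt_shift_iff {c d : BinSeq} {m : ℕ} (h : ∀ i < m, c i = d i) :
    toLex c < toLex d ↔ toLex (shift m c) < toLex (shift m d) := by
  simp only [lex_lt_iff, shift_apply]
  constructor
  · rintro ⟨n, h1, h2, h3⟩
    have : m ≤ n := by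
      by_contra hlt
      have := h n (by omega)
      simp_all
    refine ⟨n - m, fun i hi => h1 _ (by omega), ?_, ?_⟩ <;> rwa [Nat.sub_add_cancel this]
  · rintro ⟨n, h1, h2, h3⟩
    refine ⟨n + m, fun i hi => ?_, h2, h3⟩
    by_cases him : i < m
    · exact h i him
    · have := h1 (i - m) (by omega)
      rwa [Nat.sub_add_cancel (by omega)] at this

lemma lex_le_shift_iff {c d : BinSeq} {m : ℕ} (h : ∀ i < m, c i = d i) :
    toLex c ≤ toLex d ↔ toLex (shift m c) ≤ toLex (shift m d) := by
  have := lex_lt_shift_iff (c := d) (d := c) (m := m) (fun i hi => (h i hi).symm)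
  rw [← lex_not_lt, ← lex_not_lt, this]

lemma consSeq_lt_iff {p : Bool} {c d : BinSeq} :
    toLex (consSeq p c) < toLex (consSeq p d) ↔ toLex c < toLex d :=
  lex_lt_shift_iff (m := 1) (by intro i hi; obtain rfl : i = 0 := by omega
                                rfl)

lemma consSeq_le_iff {p : Bool} {c d : BinSeq} :
    toLex (consSeq p c) ≤ toLex (consSeq p d) ↔ toLex c ≤ toLex d := by
  rw [← lex_not_lt, ← lex_not_lt, consSeq_lt_iff]

lemma flip_lt_iff {c d : BinSeq} : toLex (flip c) < toLex (flip d) ↔ toLex d < toLex c := by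
  simp only [lex_lt_iff, flip_apply]
  constructor <;> rintro ⟨n, h1, h2, h3⟩ <;>
    exact ⟨n, fun i hi => by have := h1 i hi; simp_all, by simpa using h3, by simpa using h2⟩

lemma flip_le_iff {c d : BinSeq} : toLex (flip c) ≤ toLex (flip d) ↔ toLex d ≤ toLex c := by
  rw [← lex_not_lt, ← lex_not_lt, flip_lt_iff]

lemma flip_injective : Function.Injective flip := fun c d h => by
  rw [← flip_flip c, h, flip_flip]

lemma le_ones (c : BinSeq) : toLex c ≤ toLex (fun _ => true : BinSeq) := by
  rw [← lex_not_lt, lex_lt_iff]; simp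

lemma zeros_le (c : BinSeq) : toLex (fun _ => false : BinSeq) ≤ toLex c := by
  rw [← lex_not_lt, lex_lt_iff]; simp

/-- `0z ≤ z` for every sequence `z`. -/
lemma le_shift_one_of_false {z : BinSeq} (h : z 0 = false) : toLex z ≤ toLex (shift 1 z) := by
  rw [← lex_not_lt, lex_lt_iff]
  rintro ⟨n, h1, h2, h3⟩
  have : ∀ i ≤ n, z i = false := by
    intro i hi
    induction i with
    | zero => exact h
    | succ i ih => rw [← ih (by omega), ← h1 i (by omega)]; rfl
  simp [this n le_rfl] at h3

/-- `z ≤ 1z` for every sequence `z`. -/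
lemma shift_one_le_of_true {z : BinSeq} (h : z 0 = true) : toLex (shift 1 z) ≤ toLex z := by
  have := le_shift_one_of_false (z := flip z) (by simp [h])
  rwa [shift_flip, flip_le_iff] at this

/-- Sequences between two sequences with a common prefix share this prefix. -/
lemma agree_of_between {x y z : BinSeq} {m : ℕ} (h : ∀ i < m, x i = z i)
    (hxy : toLex x ≤ toLex y) (hyz : toLex y ≤ toLex z) : ∀ i < m, y i = z i := by
  by_contra hne
  push Not at hne
  obtain ⟨j, hj, hne⟩ := hne
  obtain ⟨n, h1, h2⟩ := exists_first_diff (fun h => hne (congrFun h j) : y ≠ z)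
  have hn : n < m := by
    by_contra hn
    exact hne (h1 j (by omega))
  cases hy : y n <;> cases hz : z n
  · simp_all
  · refine absurd hxy (lex_not_le.2 (lex_lt_iff.2 ⟨n, fun i hi => ?_, hy, by rw [h n hn, hz]⟩))
    rw [h1 i hi, h i (by omega)]
  · exact absurd hyz (lex_not_le.2 (lex_lt_iff.2 ⟨n, fun i hi => (h1 i hi).symm, hz, hy⟩))
  · simp_all

/-! ### The projection -/

section proj
variable {β : ℝ}

lemma summable_geometric_tail (hβ : 1 < β) : Summable fun i : ℕ => 1 / β ^ (i + 1) := by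
  have h := (summable_geometric_of_lt_one (by positivity) (inv_lt_one_of_one_lt₀ hβ)).mul_right β⁻¹
  refine h.congr fun i => ?_
  rw [← pow_succ, inv_pow, one_div]

lemma summable_proj (hβ : 1 < β) (c : BinSeq) :
    Summable fun i : ℕ => (if c i then (1 : ℝ) else 0) / β ^ (i + 1) := by
  have h0 : 0 < β := by linarith
  refine Summable.of_nonneg_of_le (fun i => ?_) (fun i => ?_) (summable_geometric_tail hβ)
  · split_ifs <;> positivity
  · gcongr; split_ifs <;> norm_num

lemma proj_nonneg (hβ : 1 < β) (c : BinSeq) : 0 ≤ proj β c := by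
  have h0 : 0 < β := by linarith
  exact tsum_nonneg fun i => by split_ifs <;> positivity

lemma proj_le (hβ : 1 < β) (c : BinSeq) : proj β c ≤ 1 / (β - 1) := by
  have h0 : 0 < β := by linarith
  have hs : ∑' i : ℕ, 1 / β ^ (i + 1) = 1 / (β - 1) := by
    have h := tsum_geometric_of_lt_one (by positivity) (inv_lt_one_of_one_lt₀ hβ)
    have h2 : ∑' i : ℕ, 1 / β ^ (i + 1) = ∑' i : ℕ, β⁻¹ ^ i * β⁻¹ :=
      tsum_congr fun i => by rw [← pow_succ, inv_pow, one_div]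
    rw [h2, tsum_mul_right, h]
    have : β - 1 ≠ 0 := by linarith
    field_simp
  rw [← hs]
  refine (summable_proj hβ c).tsum_le_tsum (fun i => ?_) (summable_geometric_tail hβ)
  gcongr; split_ifs <;> norm_num

lemma proj_eq_sum_add (hβ : 1 < β) (c : BinSeq) (m : ℕ) :
    proj β c = (∑ i ∈ Finset.range m, (if c i then (1 : ℝ) else 0) / β ^ (i + 1)) +
      proj β (shift m c) / β ^ m := by
  rw [proj, ← (summable_proj hβ c).sum_add_tsum_nat_add m, proj, ← tsum_div_const]
  congr 1
  refine tsum_congr fun i => ?_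
  rw [div_div, shift_apply, ← pow_add]; congr 2; omega

lemma proj_step (hβ : 1 < β) (c : BinSeq) :
    β * proj β c = (if c 0 then 1 else 0) + proj β (shift 1 c) := by
  have h0 : β ≠ 0 := by linarith
  rw [proj_eq_sum_add hβ c 1]
  simp only [Finset.range_one, Finset.sum_singleton, zero_add, pow_one]
  field_simp

lemma proj_sub_of_agree (hβ : 1 < β) {c d : BinSeq} {m : ℕ} (h : ∀ i < m, c i = d i) :
    proj β d - proj β c = (proj β (shift m d) - proj β (shift m c)) / β ^ m := by
  rw [proj_eq_sum_add hβ c m, proj_eq_sum_add hβ d m,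
    Finset.sum_congr rfl fun i hi => congrArg (fun b : Bool => (if b then (1 : ℝ) else 0) / β ^ (i + 1))
      (h i (Finset.mem_range.1 hi))]
  ring

/-- The source of all order comparisons: the sign is decided by the first differing digit as soon as
the tail of `c` behind it has projection at most 1. -/
lemma proj_sub_eq (hβ : 1 < β) {c d : BinSeq} {n : ℕ} (h : ∀ i < n, c i = d i)
    (hc : c n = false) (hd : d n = true) :
    proj β d - proj β c =
      (1 + proj β (shift (n + 1) d) - proj β (shift (n + 1) c)) / β ^ (n + 1) := by
  have h0 : β ≠ 0 := by linarith
  have h1 := proj_step hβ (shift n c)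
  have h2 := proj_step hβ (shift n d)
  simp only [shift_apply, zero_add, hc, hd, if_true, shift_shift] at h1 h2
  rw [proj_sub_of_agree hβ h, pow_succ, mul_comm (β ^ n), ← div_div]
  congr 1
  rw [eq_div_iff h0]
  simp only [Bool.false_eq_true, if_false] at h1
  linear_combination h2 - h1

lemma abs_proj_sub_le (hβ : 1 < β) {c d : BinSeq} {m : ℕ} (h : ∀ i < m, c i = d i) :
    |proj β d - proj β c| ≤ 1 / (β - 1) / β ^ m := by
  have h0 : 0 < β := by linarith
  rw [proj_sub_of_agree hβ h, abs_div, abs_of_pos (pow_pos h0 m)]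
  gcongr
  have h1 := proj_nonneg hβ (shift m c)
  have h2 := proj_nonneg hβ (shift m d)
  have h3 := proj_le hβ (shift m c)
  have h4 := proj_le hβ (shift m d)
  rw [abs_le]; constructor <;> linarith

lemma proj_pos_of_digit (hβ : 1 < β) {c : BinSeq} {n : ℕ} (h : c n = true) : 0 < proj β c := by
  have h0 : 0 < β := by linarith
  refine (summable_proj hβ c).tsum_pos (fun i => ?_) n ?_
  · split_ifs <;> positivity
  · rw [if_pos h]; positivity

/-- The projection is determined by the digit recursion `x_{n+1} = β x_n - c_n`. -/
lemma proj_eq_of_recursion (hβ : 1 < β) {c : BinSeq} {x : ℕ → ℝ} (h0 : ∀ n, 0 ≤ x n)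
    (h1 : ∀ n, x n ≤ 1) (hx : ∀ n, β * x n = (if c n then 1 else 0) + x (n + 1)) (n : ℕ) :
    proj β (shift n c) = x n := by
  have hb : 0 < β := by linarith
  -- Each step of the recursion multiplies the error by β, while the error stays bounded; so it is
  -- zero.
  have key : ∀ k, ∀ n, proj β (shift n c) - x n = (proj β (shift (n + k) c) - x (n + k)) / β ^ k := by
    intro k
    induction k with
    | zero => intro n; simp
    | succ k ih =>
      intro n
      rw [ih n, pow_succ, mul_comm (β ^ k), ← div_div]
      congr 1
      rw [eq_div_iff hb.ne']
      have e1 := proj_step hβ (shift (n + k) c)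
      have e2 := hx (n + k)
      simp only [shift_apply, zero_add, shift_shift] at e1
      rw [← add_assoc n k 1]
      linear_combination e1 - e2
  have hbd : ∀ k, |proj β (shift n c) - x n| ≤ (1 / (β - 1) + 1) / β ^ k := by
    intro k
    rw [key k n, abs_div, abs_of_pos (pow_pos hb k)]
    gcongr
    have a1 := proj_nonneg hβ (shift (n + k) c)
    have a2 := proj_le hβ (shift (n + k) c)
    have a3 := h0 (n + k)
    have a4 := h1 (n + k)
    rw [abs_le]; constructor <;> linarith
  have hl : Tendsto (fun k : ℕ => (1 / (β - 1) + 1) / β ^ k) atTop (𝓝 0) :=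
    tendsto_const_nhds.div_atTop (tendsto_pow_atTop_atTop_of_one_lt hβ)
  have := ge_of_tendsto hl (Eventually.of_forall hbd)
  have := abs_nonpos_iff.1 this
  linarith

end proj

/-! ### Admissible sequences -/

section admissible
variable {β : ℝ}

lemma proj_mono (hβ : 1 < β) {c d : BinSeq} (hc : ∀ n, proj β (shift n c) ≤ 1)
    (h : toLex c ≤ toLex d) : proj β c ≤ proj β d := by
  rcases eq_or_lt_of_le h with h | h
  · rw [toLex_inj.1 h]
  obtain ⟨n, h1, h2, h3⟩ := lex_lt_iff.1 h
  have h0 : 0 < β := by linarith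
  have e := proj_sub_eq hβ h1 h2 h3
  have : 0 ≤ (1 + proj β (shift (n + 1) d) - proj β (shift (n + 1) c)) / β ^ (n + 1) :=
    div_nonneg (by linarith [hc (n + 1), proj_nonneg hβ (shift (n + 1) d)]) (by positivity)
  linarith

lemma proj_lt_of_tail_pos (hβ : 1 < β) {c d : BinSeq} (hc : ∀ n, proj β (shift n c) ≤ 1)
    (hd : ∀ n, 0 < proj β (shift n d)) (h : toLex c < toLex d) : proj β c < proj β d := by
  obtain ⟨n, h1, h2, h3⟩ := lex_lt_iff.1 h
  have h0 : 0 < β := by linarith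
  have e := proj_sub_eq hβ h1 h2 h3
  have : 0 < (1 + proj β (shift (n + 1) d) - proj β (shift (n + 1) c)) / β ^ (n + 1) :=
    div_pos (by linarith [hc (n + 1), hd (n + 1)]) (by positivity)
  linarith

/-- All tails of `c` have projection less than `1`; these are the greedy expansions of the points
of `[0,1)`. -/
def Admissible (β : ℝ) (c : BinSeq) : Prop := ∀ n, proj β (shift n c) < 1

lemma Admissible.shift (h : Admissible β c) (k : ℕ) : Admissible β (shift k c) := fun n => by
  rw [shift_shift]; exact h _

lemma Admissible.proj_lt (hβ : 1 < β) {c d : BinSeq} (hc : Admissible β c)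
    (h : toLex c < toLex d) : proj β c < proj β d := by
  obtain ⟨n, h1, h2, h3⟩ := lex_lt_iff.1 h
  have h0 : 0 < β := by linarith
  have e := proj_sub_eq hβ h1 h2 h3
  have : 0 < (1 + proj β (BetaHole.shift (n + 1) d) - proj β (BetaHole.shift (n + 1) c)) /
      β ^ (n + 1) :=
    div_pos (by linarith [hc (n + 1), proj_nonneg hβ (BetaHole.shift (n + 1) d)]) (by positivity)
  linarith

lemma Admissible.proj_le (hβ : 1 < β) {c d : BinSeq} (hc : Admissible β c)
    (h : toLex c ≤ toLex d) : proj β c ≤ proj β d :=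
  proj_mono hβ (fun n => (hc n).le) h

lemma Admissible.lex_le_of_proj_le (hβ : 1 < β) {c d : BinSeq} (hd : Admissible β d)
    (h : proj β c ≤ proj β d) : toLex c ≤ toLex d := by
  rw [← lex_not_lt]; intro hlt
  exact absurd (hd.proj_lt hβ hlt) (not_lt.2 h)

lemma Admissible.isGreedy (hβ : 1 < β) {c : BinSeq} (hc : Admissible β c) :
    IsGreedy β (proj β c) c :=
  ⟨rfl, fun _ hd => hc.lex_le_of_proj_le hβ hd.le⟩

lemma Admissible.betaMap_iterate (hβ : 1 < β) {c : BinSeq} (hc : Admissible β c) (n : ℕ) :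
    (betaMap β)^[n] (proj β c) = proj β (BetaHole.shift n c) := by
  induction n with
  | zero => rfl
  | succ n ih =>
    rw [Function.iterate_succ_apply', ih, betaMap, proj_step hβ, shift_shift]
    have h1 := hc (n + 1)
    have h2 := proj_nonneg hβ (BetaHole.shift (n + 1) c)
    split_ifs
    · have : (1 : ℝ) = ((1 : ℤ) : ℝ) := by simp
      rw [this, Int.fract_intCast_add, Int.fract_eq_self.2 ⟨h2, h1⟩]
    · rw [zero_add, Int.fract_eq_self.2 ⟨h2, h1⟩]

lemma betaMap_iterate_mem {x : ℝ} (hx : x ∈ Ico (0 : ℝ) 1) (n : ℕ) :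
    (betaMap β)^[n] x ∈ Ico (0 : ℝ) 1 := by
  cases n with
  | zero => exact hx
  | succ n =>
    rw [Function.iterate_succ_apply']
    exact ⟨Int.fract_nonneg _, Int.fract_lt_one _⟩

lemma exists_admissible (hβ : 1 < β) (hβ2 : β ≤ 2) {x : ℝ} (hx : x ∈ Ico (0 : ℝ) 1) :
    ∃ c, Admissible β c ∧ proj β c = x := by
  set y : ℕ → ℝ := fun n => (betaMap β)^[n] x with hy
  have hmem : ∀ n, y n ∈ Ico (0 : ℝ) 1 := betaMap_iterate_mem hx
  set c : BinSeq := fun n => decide (1 ≤ β * y n) with hc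
  have key := proj_eq_of_recursion hβ (c := c) (x := y) (fun n => (hmem n).1)
    (fun n => (hmem n).2.le) (fun n => by
      have h1 := (hmem n).1
      have h2 := (hmem n).2
      have h3 : y (n + 1) = Int.fract (β * y n) := by
        simp only [hy, Function.iterate_succ_apply', betaMap]
      have h4 : β * y n < 2 := by nlinarith
      have h5 : 0 ≤ β * y n := by positivity
      rw [h3]
      simp only [hc, decide_eq_true_eq]
      split_ifs with h
      · have : ⌊β * y n⌋ = 1 := by
          rw [Int.floor_eq_iff]; push_cast; exact ⟨h, by linarith⟩
        rw [Int.fract, this]; push_cast; ring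
      · rw [Int.fract_eq_self.2 ⟨h5, not_le.1 h⟩]; ring)
  exact ⟨c, fun n => by rw [key]; exact (hmem n).2, key 0⟩

/-! ### The quasi-greedy expansion of 1 and Parry's criterion. -/

/-- `A` is the quasi-greedy expansion of `1`, described through the projections of its tails. -/
def QuasiGreedyTails (β : ℝ) (A : BinSeq) : Prop :=
  proj β A = 1 ∧ ∀ n, 0 < proj β (shift n A) ∧ proj β (shift n A) ≤ 1

/-- The digits come from the orbit of 1 under the variant of T_β on (0,1] that subtracts 1 only when
βx > 1; the strict inequality keeps the orbit positive. -/
lemma exists_quasiGreedyTails (hβ : 1 < β) (hβ2 : β ≤ 2) : ∃ A, QuasiGreedyTails β A := by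
  set q : ℝ → ℝ := fun x => if 1 < β * x then β * x - 1 else β * x with hq
  set y : ℕ → ℝ := fun n => q^[n] 1 with hy
  have hs : ∀ n, y (n + 1) = q (y n) := fun n => by
    simp only [hy, Function.iterate_succ_apply']
  have hmem : ∀ n, 0 < y n ∧ y n ≤ 1 := by
    intro n
    induction n with
    | zero => simp [hy]
    | succ n ih =>
      rw [hs, hq]
      dsimp only
      split_ifs with h
      · exact ⟨by linarith, by nlinarith⟩
      · exact ⟨by nlinarith, not_lt.1 h⟩
  have key := proj_eq_of_recursion hβ (c := fun n => decide (1 < β * y n)) (x := y)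
    (fun n => (hmem n).1.le) (fun n => (hmem n).2) (fun n => by
      rw [hs, hq]
      simp only [decide_eq_true_eq]
      split_ifs <;> ring)
  exact ⟨fun n => decide (1 < β * y n), key 0, fun n => by rw [key]; exact hmem n⟩

lemma exists_digit_of_proj_pos {c : BinSeq} (h : 0 < proj β c) : ∃ i, c i = true := by
  by_contra hne
  push Not at hne
  refine h.ne' ?_
  rw [proj]
  refine (tsum_congr fun i => ?_).trans tsum_zero
  rw [if_neg (hne _), zero_div]

lemma NotEndingInZeros.proj_pos (hβ : 1 < β) {c : BinSeq} (h : NotEndingInZeros c) (n : ℕ) :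
    0 < proj β (shift n c) := by
  obtain ⟨m, hm, h⟩ := h n
  exact proj_pos_of_digit hβ (n := m - n) (by simpa [Nat.sub_add_cancel hm] using h)

lemma IsQuasiGreedy.tails (hβ : 1 < β) (hβ2 : β ≤ 2) {a : BinSeq} (h : IsQuasiGreedy β a) :
    QuasiGreedyTails β a := by
  obtain ⟨A, hA⟩ := exists_quasiGreedyTails hβ hβ2
  have hAz : NotEndingInZeros A := by
    intro N
    obtain ⟨i, hi⟩ := exists_digit_of_proj_pos (hA.2 N).1
    exact ⟨i + N, by omega, hi⟩
  have h1 : toLex A ≤ toLex a := h.2 A hA.1 hAz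
  have h2 : toLex a ≤ toLex A := by
    rw [← lex_not_lt]; intro hlt
    have := proj_lt_of_tail_pos hβ (fun n => (hA.2 n).2) (h.1.2.proj_pos hβ) hlt
    rw [hA.1, h.1.1] at this
    exact lt_irrefl _ this
  rwa [toLex_inj.1 (le_antisymm h2 h1)]

lemma proj_anti {β₁ β₂ : ℝ} (h1 : 1 < β₁) (h : β₁ ≤ β₂) (c : BinSeq) :
    proj β₂ c ≤ proj β₁ c := by
  have h0 : 0 < β₁ := by linarith
  refine (summable_proj (by linarith) c).tsum_le_tsum (fun i => ?_) (summable_proj h1 c)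
  split_ifs
  · gcongr
  · simp

/-- If the order were reversed, `A₁` would project above 1 in base `β₂`; but enlarging the base can
only lower the projection 1 that `A₁` has in base `β₁`. -/
lemma QuasiGreedyTails.mono {β₁ β₂ : ℝ} (h1 : 1 < β₁) (h : β₁ ≤ β₂) {A₁ A₂ : BinSeq}
    (hA₁ : QuasiGreedyTails β₁ A₁) (hA₂ : QuasiGreedyTails β₂ A₂) : toLex A₁ ≤ toLex A₂ := by
  have hβ : 1 < β₂ := by linarith
  rw [← lex_not_lt]; intro hlt
  have hpos : ∀ n, 0 < proj β₂ (shift n A₁) := by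
    intro n
    obtain ⟨i, hi⟩ := exists_digit_of_proj_pos (hA₁.2 n).1
    exact proj_pos_of_digit hβ hi
  have h2 := proj_lt_of_tail_pos hβ (fun n => (hA₂.2 n).2) hpos hlt
  have h3 := proj_anti h1 h A₁
  rw [hA₂.1] at h2
  rw [hA₁.1] at h3
  linarith

/-- Parry's criterion. It moves the dynamics of T_β to the lexicographic order. -/
lemma QuasiGreedyTails.admissible_iff (hβ : 1 < β) {A : BinSeq} (hA : QuasiGreedyTails β A)
    (c : BinSeq) : Admissible β c ↔ ∀ n, toLex (shift n c) < toLex A := by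
  have h0 : 0 < β := by linarith
  constructor
  · intro h n
    exact (lt_or_ge _ _).resolve_right fun hle => by
      have := proj_mono hβ (fun n => (hA.2 n).2) hle
      rw [hA.1] at this
      exact absurd (h n) (not_lt.2 this)
  · intro h
    -- A bootstrap: a uniform excess `B` of the tails over 1 improves to `B / β`, because behind the
    -- first digit where a tail drops below `A` the excess is divided by a power of β. Iteration
    -- leaves the bound 1, and positivity of the tails of `A` makes it strict.
    have step : ∀ B : ℝ, (∀ n, proj β (shift n c) ≤ 1 + B) → 0 ≤ B →
        ∀ n, proj β (shift n c) ≤ 1 + B / β := by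
      intro B hB hB0 n
      obtain ⟨m, h1, h2, h3⟩ := lex_lt_iff.1 (h n)
      have e := proj_sub_eq hβ h1 h2 h3
      rw [hA.1, shift_shift] at e
      have e1 := hB (n + (m + 1))
      have e2 := (hA.2 (m + 1)).1
      have e3 : (-B) / β ^ (m + 1) ≤ (1 + proj β (shift (m + 1) A) -
          proj β (shift (n + (m + 1)) c)) / β ^ (m + 1) := by
        gcongr; linarith
      have e4 : B / β ^ (m + 1) ≤ B / β := by
        have : β ≤ β ^ (m + 1) := le_self_pow₀ hβ.le (by omega)
        gcongr
      rw [neg_div] at e3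
      linarith
    have hall : ∀ k n, proj β (shift n c) ≤ 1 + 1 / (β - 1) / β ^ k := by
      intro k
      induction k with
      | zero => intro n; have := proj_le hβ (shift n c); simp only [pow_zero, div_one]; linarith
      | succ k ih =>
        intro n
        have := step _ ih (by have : 0 < β - 1 := by linarith
                              positivity) n
        rwa [div_div, ← pow_succ] at this
    have hle : ∀ n, proj β (shift n c) ≤ 1 := by
      intro n
      have hl : Tendsto (fun k : ℕ => 1 + 1 / (β - 1) / β ^ k) atTop (𝓝 (1 + 0)) :=
        tendsto_const_nhds.add
          (tendsto_const_nhds.div_atTop (tendsto_pow_atTop_atTop_of_one_lt hβ))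
      rw [add_zero] at hl
      exact ge_of_tendsto hl (Eventually.of_forall fun k => hall k n)
    intro n
    have := proj_lt_of_tail_pos hβ (c := shift n c) (fun m => by rw [shift_shift]; exact hle _)
      (fun m => (hA.2 m).1) (h n)
    rwa [hA.1] at this

/-! ### Survivor sets and the bifurcation set -/

lemma mem_survivor_iff (hβ : 1 < β) (hβ2 : β ≤ 2) {t x : ℝ} :
    x ∈ survivor β t ↔ ∃ c, Admissible β c ∧ proj β c = x ∧ ∀ n, t ≤ proj β (shift n c) := by
  constructor
  · rintro ⟨hx, h⟩
    obtain ⟨c, hc, rfl⟩ := exists_admissible hβ hβ2 hx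
    exact ⟨c, hc, rfl, fun n => by rw [← hc.betaMap_iterate hβ]; exact h n⟩
  · rintro ⟨c, hc, rfl, h⟩
    exact ⟨⟨proj_nonneg hβ c, hc 0⟩, fun n => by rw [hc.betaMap_iterate hβ]; exact h n⟩

/-- The fractional part jumps only from the left, so just to the right of any point the iterate is
affine of slope `β ^ n`. -/
lemma betaMap_iterate_right (hβ : 1 < β) (t : ℝ) (n : ℕ) : ∃ ε > 0, ∀ y, t ≤ y → y < t + ε →
    (betaMap β)^[n] y = (betaMap β)^[n] t + β ^ n * (y - t) := by
  have h0 : 0 < β := by linarith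
  induction n with
  | zero => exact ⟨1, one_pos, fun y _ _ => by simp⟩
  | succ n ih =>
    obtain ⟨ε, hε, h⟩ := ih
    set u := (betaMap β)^[n] t with hu
    have hfr := Int.fract_lt_one (β * u)
    refine ⟨min ε ((1 - Int.fract (β * u)) / β ^ (n + 1)),
      lt_min hε (div_pos (by linarith) (by positivity)), fun y h1 h2 => ?_⟩
    have h3 : y - t < (1 - Int.fract (β * u)) / β ^ (n + 1) := by
      have := min_le_right ε ((1 - Int.fract (β * u)) / β ^ (n + 1)); linarith
    have h4 : y < t + ε := by
      have := min_le_left ε ((1 - Int.fract (β * u)) / β ^ (n + 1)); linarith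
    rw [lt_div_iff₀ (by positivity)] at h3
    have h5 : 0 ≤ β ^ (n + 1) * (y - t) := mul_nonneg (by positivity) (by linarith)
    rw [Function.iterate_succ_apply', Function.iterate_succ_apply', h y h1 h4, ← hu, betaMap,
      betaMap]
    have e : β * (u + β ^ n * (y - t)) =
        (⌊β * u⌋ : ℝ) + (Int.fract (β * u) + β ^ (n + 1) * (y - t)) := by
      rw [Int.fract]; ring
    rw [e, Int.fract_intCast_add, Int.fract_eq_self]
    exact ⟨by linarith [Int.fract_nonneg (β * u)], by linarith⟩

lemma mem_bifurcationSet_iff (hβ : 1 < β) {t : ℝ} :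
    t ∈ bifurcationSet β ↔ t ∈ Ico (0 : ℝ) 1 ∧ ∀ n, t ≤ (betaMap β)^[n] t := by
  constructor
  · rintro ⟨ht, h⟩
    refine ⟨ht, fun n => ?_⟩
    by_contra hlt
    push Not at hlt
    obtain ⟨ε, hε, hr⟩ := betaMap_iterate_right hβ t n
    have hp : 0 < β ^ n := pow_pos (by linarith) n
    -- Points of [t, t + δ) are sent below t by the n-th iterate, so no orbit counted in the
    -- survivor set of t visits this interval, and t + δ has the same survivor set.
    set δ := min ε ((t - (betaMap β)^[n] t) / β ^ n) with hδ
    have hδ0 : 0 < δ := lt_min hε (div_pos (by linarith) hp)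
    refine h (t + δ) (by linarith) (Set.Subset.antisymm (fun x hx => ⟨hx.1, fun m => by
      linarith [hx.2 m]⟩) fun x hx => ⟨hx.1, fun m => ?_⟩)
    by_contra hm
    push Not at hm
    have h1 := hr _ (hx.2 m) (hm.trans_le (by linarith [min_le_left ε ((t - (betaMap β)^[n] t) / β ^ n)]))
    have h2 : (betaMap β)^[m] x - t < (t - (betaMap β)^[n] t) / β ^ n := by
      linarith [min_le_right ε ((t - (betaMap β)^[n] t) / β ^ n)]
    rw [lt_div_iff₀ hp] at h2
    have h3 := hx.2 (n + m)
    rw [Function.iterate_add_apply, h1] at h3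
    linarith
  · rintro ⟨ht, h⟩
    refine ⟨ht, fun t' htt' he => ?_⟩
    have : t ∈ survivor β t' := he ▸ ⟨ht, h⟩
    exact absurd (this.2 0) (not_le.2 htt')

end admissible

/-! ### Lyndon pairs and the substitution on sequences -/

/-- `a = S^∞` and `b = 𝕃(S)^∞` for a Lyndon word `S` of length `N` with first digit `0` and last
digit `1`. -/
structure LyndonPair (N : ℕ) (a b : BinSeq) : Prop where
  pos : 0 < N
  per : ∀ i, a (i + N) = a i
  a_first : a 0 = false
  a_last : a (N - 1) = true
  b_first : b 0 = true
  b_last : b (N - 1) = false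
  min : ∀ k, toLex a ≤ toLex (shift k a)
  max : ∀ k, toLex (shift k a) ≤ toLex b
  orbit : ∃ j, b = shift j a
  prim : ∀ k, shift k a = a → N ∣ k

/-- The substitution `Φ` on a sequence `e`, whose digit `e 0` only serves as the predecessor of
`e 1`. -/
def inflate (N : ℕ) (a b e : BinSeq) : BinSeq := fun i =>
  if N ∣ i + 1 then e ((i + 1) / N) else cond (e (i / N)) (a i) (b i)

/-- The sequence `𝕃(S)⁺ S^∞`. -/
def upperSeq (N : ℕ) (a b : BinSeq) : BinSeq := inflate N a b (consSeq false fun _ => true)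

/-- The sequence `S⁻ 𝕃(S)^∞`. -/
def lowerSeq (N : ℕ) (a b : BinSeq) : BinSeq := inflate N a b (consSeq true fun _ => false)

lemma shift_per {N : ℕ} {a : BinSeq} (h : ∀ i, a (i + N) = a i) : shift N a = a := funext h

lemma per_mul {N : ℕ} {a : BinSeq} (h : ∀ i, a (i + N) = a i) (m i : ℕ) :
    a (i + N * m) = a i := by
  induction m with
  | zero => simp
  | succ m ih => rw [Nat.mul_succ, ← add_assoc, h, ih]

lemma inflate_of_eq {N : ℕ} (hN : 0 < N) (a b e : BinSeq) {i k : ℕ} (hk : i + 1 = N * k) :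
    inflate N a b e i = e k := by
  rw [inflate, if_pos ⟨k, hk⟩, hk, Nat.mul_div_cancel_left _ hN]

lemma inflate_of_not_dvd {N : ℕ} (a b e : BinSeq) {i : ℕ} (hi : ¬ N ∣ i + 1) :
    inflate N a b e i = cond (e (i / N)) (a i) (b i) := if_neg hi

lemma inflate_agree {N m : ℕ} {a b e e' : BinSeq} (h : ∀ i < m, e i = e' i) {i : ℕ}
    (hi : i + 1 < N * m) : inflate N a b e i = inflate N a b e' i := by
  have e1 : (i + 1) / N < m := Nat.div_lt_of_lt_mul hi
  have e2 : i / N < m := Nat.div_lt_of_lt_mul (by omega)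
  simp only [inflate, h _ e1, h _ e2]

/-- Exchanging the digits turns the pair (a, b) into (flip b, flip a); this symmetry gives the lower
bounds from the upper ones. -/
lemma flip_inflate (N : ℕ) (a b e : BinSeq) :
    flip (inflate N a b e) = inflate N (flip b) (flip a) (flip e) := by
  funext i
  simp only [flip_apply, inflate]
  split_ifs
  · rfl
  · cases e (i / N) <;> rfl

/-- The first digits of an inflated sequence. -/
lemma inflate_first {N : ℕ} {a b : BinSeq} (e : BinSeq) (i : ℕ) (hi : i + 1 < N) :
    inflate N a b e i = cond (e 0) (a i) (b i) := by
  have h1 : ¬ N ∣ i + 1 := fun hd => by have := Nat.le_of_dvd (by omega) hd; omega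
  rw [inflate_of_not_dvd _ _ _ h1, Nat.div_eq_of_lt (by omega : i < N)]

lemma upperSeq_first {N : ℕ} {a b : BinSeq} (i : ℕ) (hi : i + 1 < N) : upperSeq N a b i = b i := by
  rw [upperSeq, inflate_first _ i hi]; rfl

lemma lowerSeq_first {N : ℕ} {a b : BinSeq} (i : ℕ) (hi : i + 1 < N) : lowerSeq N a b i = a i := by
  rw [lowerSeq, inflate_first _ i hi]; rfl

lemma agree_lowerSeq {N : ℕ} {a b : BinSeq} {x : BinSeq} (h1 : toLex (lowerSeq N a b) ≤ toLex x) (h2 : toLex x ≤ toLex a)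
    (i : ℕ) (hi : i + 1 < N) : x i = a i :=
  agree_of_between (m := N - 1) (fun i hi => lowerSeq_first i (by omega)) h1 h2 i (by omega)

lemma agree_upperSeq {N : ℕ} {a b : BinSeq} {x : BinSeq} (h1 : toLex b ≤ toLex x) (h2 : toLex x ≤ toLex (upperSeq N a b))
    (i : ℕ) (hi : i + 1 < N) : x i = b i := by
  rw [← upperSeq_first (a := a) (b := b) i hi]
  refine agree_of_between (m := N - 1) (fun i hi => ?_) h1 h2 i (by omega)
  rw [upperSeq_first i (by omega)]

lemma flip_lowerSeq (N : ℕ) (a b : BinSeq) :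
    flip (lowerSeq N a b) = upperSeq N (flip b) (flip a) := by
  rw [lowerSeq, flip_inflate, upperSeq]
  congr 1
  funext i; cases i <;> rfl

namespace LyndonPair
variable {N : ℕ} {a b : BinSeq} (h : LyndonPair N a b)
include h

lemma two_le : 2 ≤ N := by
  by_contra hN
  obtain rfl : N = 1 := by have := h.pos; omega
  have h1 := h.a_first
  have h2 := h.a_last
  simp_all

lemma shift_mul (m : ℕ) : shift (N * m) a = a := funext fun i => per_mul h.per m i

lemma b_per (i : ℕ) : b (i + N) = b i := by
  obtain ⟨j, rfl⟩ := h.orbit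
  simp only [shift_apply]
  rw [← h.per (i + j)]; congr 1; omega

lemma orbit' : ∃ j, a = shift j b := by
  obtain ⟨j, rfl⟩ := h.orbit
  refine ⟨N * j - j, ?_⟩
  have : j ≤ N * j := Nat.le_mul_of_pos_left j h.pos
  rw [shift_shift, Nat.add_sub_cancel' this, h.shift_mul]

lemma shift_b_le (k : ℕ) : toLex (shift k b) ≤ toLex b := by
  obtain ⟨j, hj⟩ := h.orbit
  conv_lhs => rw [hj]
  rw [shift_shift]
  exact h.max _

lemma le_shift_b (k : ℕ) : toLex a ≤ toLex (shift k b) := by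
  obtain ⟨j, hj⟩ := h.orbit
  rw [hj, shift_shift]
  exact h.min _

lemma prim_b (k : ℕ) (hk : shift k b = b) : N ∣ k := by
  obtain ⟨j, hj⟩ := h.orbit'
  refine h.prim k ?_
  rw [hj, shift_shift, add_comm, ← shift_shift, hk]

lemma flip : LyndonPair N (flip b) (flip a) where
  pos := h.pos
  per i := by simp [h.b_per]
  a_first := by simp [h.b_first]
  a_last := by simp [h.b_last]
  b_first := by simp [h.a_first]
  b_last := by simp [h.a_last]
  min k := by rw [shift_flip, flip_le_iff]; exact h.shift_b_le k
  max k := by rw [shift_flip, flip_le_iff]; exact h.le_shift_b k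
  orbit := by obtain ⟨j, hj⟩ := h.orbit'; exact ⟨j, by rw [shift_flip, ← hj]⟩
  prim k hk := h.prim_b k (by rw [shift_flip] at hk; exact flip_injective hk)

lemma last_digit (i : ℕ) (hi : N ∣ i + 1) : a i = true ∧ b i = false := by
  obtain ⟨m, hm⟩ := hi
  have hpos := h.pos
  obtain ⟨m, rfl⟩ : ∃ k, m = k + 1 := ⟨m - 1, by cases m <;> simp_all⟩
  obtain rfl : i = N - 1 + N * m := by rw [Nat.mul_succ] at hm; omega
  exact ⟨by rw [per_mul h.per, h.a_last], by rw [per_mul h.b_per, h.b_last]⟩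

lemma inflate_ones : inflate N a b (fun _ => true) = a := by
  funext i
  simp only [inflate]
  split_ifs with hi
  · exact (h.last_digit i hi).1.symm
  · rfl

lemma inflate_zeros : inflate N a b (fun _ => false) = b := by
  funext i
  simp only [inflate]
  split_ifs with hi
  · exact (h.last_digit i hi).2.symm
  · rfl

lemma shift_inflate (m : ℕ) (e : BinSeq) :
    shift (N * m) (inflate N a b e) = inflate N a b (shift m e) := by
  funext i
  rw [shift_apply]
  by_cases hi : N ∣ i + 1
  · obtain ⟨k, hk⟩ := hi
    rw [inflate_of_eq h.pos a b _ hk, inflate_of_eq h.pos a b e (k := k + m)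
      (by rw [Nat.mul_add]; omega), shift_apply]
  · have hi' : ¬ N ∣ i + N * m + 1 := by
      rwa [add_right_comm, Nat.dvd_add_left (Dvd.intro m rfl)]
    rw [inflate_of_not_dvd _ _ _ hi, inflate_of_not_dvd _ _ _ hi', Nat.add_mul_div_left _ _ h.pos,
      per_mul h.per, per_mul h.b_per, shift_apply]

lemma inflate_head (e : BinSeq) : inflate N a b e 0 = !e 0 := by
  have h2 := h.two_le
  have : ¬ N ∣ 0 + 1 := by rw [Nat.dvd_one]; omega
  rw [inflate_of_not_dvd _ _ _ this, Nat.zero_div, h.a_first, h.b_first]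
  cases e 0 <;> rfl

/-- Digit m ≥ 1 of `e` is the last digit of block m - 1, and the rest of a block depends only on the
digit that precedes it. So the first difference of `e` and `e'` at m becomes the first difference of
the images at N * m - 1, with the same sign. For different heads the order is reversed, see
`inflate_lt_of_head`. -/
lemma inflate_lt_of_lt {e e' : BinSeq} (h0 : e 0 = e' 0) (hlt : toLex e < toLex e') :
    toLex (inflate N a b e) < toLex (inflate N a b e') := by
  obtain ⟨m, h1, h2, h3⟩ := lex_lt_iff.1 hlt
  have hpos := h.pos
  have hm : m ≠ 0 := by rintro rfl; simp_all
  have hNm : 0 < N * m := Nat.mul_pos hpos (by omega)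
  have hl : N * m - 1 + 1 = N * m := Nat.sub_add_cancel hNm
  exact lex_lt_iff.2 ⟨N * m - 1, fun i hi => inflate_agree h1 (by omega),
    by rw [inflate_of_eq hpos a b e hl, h2], by rw [inflate_of_eq hpos a b e' hl, h3]⟩

lemma inflate_lt_iff {e e' : BinSeq} (h0 : e 0 = e' 0) :
    toLex (inflate N a b e) < toLex (inflate N a b e') ↔ toLex e < toLex e' := by
  refine ⟨fun hlt => ?_, h.inflate_lt_of_lt h0⟩
  rw [← lex_not_le]; intro hle
  rcases eq_or_lt_of_le hle with he | hl
  · rw [toLex_inj.1 he] at hlt; exact lt_irrefl _ hlt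
  · exact lt_asymm hlt (h.inflate_lt_of_lt h0.symm hl)

lemma inflate_le_iff {e e' : BinSeq} (h0 : e 0 = e' 0) :
    toLex (inflate N a b e) ≤ toLex (inflate N a b e') ↔ toLex e ≤ toLex e' := by
  rw [← lex_not_lt, ← lex_not_lt, h.inflate_lt_iff h0.symm]

lemma inflate_cons_le_iff {p : Bool} {c d : BinSeq} :
    toLex (inflate N a b (consSeq p c)) ≤ toLex (inflate N a b (consSeq p d)) ↔
      toLex c ≤ toLex d := by
  rw [h.inflate_le_iff (e := consSeq p c) (e' := consSeq p d) rfl, consSeq_le_iff]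

lemma inflate_cons_lt_iff {p : Bool} {c d : BinSeq} :
    toLex (inflate N a b (consSeq p c)) < toLex (inflate N a b (consSeq p d)) ↔
      toLex c < toLex d := by
  rw [h.inflate_lt_iff (e := consSeq p c) (e' := consSeq p d) rfl, consSeq_lt_iff]

lemma inflate_lt_of_head {e e' : BinSeq} (h1 : e 0 = true) (h2 : e' 0 = false) :
    toLex (inflate N a b e) < toLex (inflate N a b e') :=
  lex_lt_of_head (by rw [h.inflate_head, h1]; rfl) (by rw [h.inflate_head, h2]; rfl)

lemma inflate_last (e : BinSeq) : inflate N a b e (N - 1) = e 1 :=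
  inflate_of_eq h.pos a b e (by rw [Nat.mul_one]; exact Nat.sub_add_cancel h.pos)

/-! ### Tails of substituted sequences that start inside a block. -/

lemma lt_of_agree {x y B : BinSeq} (hB : ∀ i, i + 1 < N → B i = b i) (hBl : B (N - 1) = true)
    (hx : toLex x ≤ toLex b) (hy : ∀ i < N, y i = x i) : toLex y < toLex B := by
  have hpos := h.pos
  rcases eq_or_lt_of_le hx with he | hlt
  · have he := toLex_inj.1 he
    subst he
    refine lex_lt_iff.2 ⟨N - 1, fun i hi => ?_, ?_, hBl⟩
    · rw [hy i (by omega), hB i (by omega)]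
    · rw [hy _ (by omega), h.b_last]
  · obtain ⟨n, h1, h2, h3⟩ := lex_lt_iff.1 hlt
    have hn : n ≠ N - 1 := by rintro rfl; rw [h.b_last] at h3; cases h3
    by_cases hnN : n < N
    · refine lex_lt_iff.2 ⟨n, fun i hi => ?_, ?_, ?_⟩
      · rw [hy i (by omega), hB i (by omega), h1 i hi]
      · rw [hy n hnN, h2]
      · rw [hB n (by omega), h3]
    · refine lex_lt_iff.2 ⟨N - 1, fun i hi => ?_, ?_, hBl⟩
      · rw [hy i (by omega), hB i (by omega), h1 i (by omega)]
      · rw [hy _ (by omega), h1 _ (by omega), h.b_last]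

lemma b_lt {B : BinSeq} (hB : ∀ i, i + 1 < N → B i = b i) (hBl : B (N - 1) = true) :
    toLex b < toLex B :=
  h.lt_of_agree hB hBl le_rfl fun _ _ => rfl

/-- The digits at an offset `l` that is not a multiple of the block length. -/
lemma inflate_offset (e : BinSeq) {l : ℕ} (hl0 : 0 < l) (hl : l < N) :
    (∀ i < N - l - 1, shift l (inflate N a b e) i = cond (e 0) (a (i + l)) (b (i + l))) ∧
    shift l (inflate N a b e) (N - l - 1) = e 1 ∧
    (∀ i, N - l ≤ i → i < N → shift l (inflate N a b e) i =
      cond (e 1) (a (i + l)) (b (i + l))) := by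
  refine ⟨fun i hi => ?_, ?_, fun i hi1 hi2 => ?_⟩
  · rw [shift_apply, inflate_first e _ (by omega)]
  · rw [shift_apply, show N - l - 1 + l = N - 1 by omega, h.inflate_last]
  · have h1 : ¬ N ∣ i + l + 1 := fun hd => by
      obtain ⟨m, hm⟩ := hd
      rcases m with _ | _ | m
      · omega
      · omega
      · have : N * 2 ≤ N * (m + 1 + 1) := Nat.mul_le_mul_left N (by omega)
        omega
    have h2 : (i + l) / N = 1 := Nat.div_eq_of_lt_le (by omega) (by omega)
    rw [shift_apply, inflate_of_not_dvd _ _ _ h1, h2]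

/-- The window of length N at offset `l` is an end piece of `a` or `b` closed by the digit `e 1`,
then an initial piece chosen by `e 1`. In each of the four cases it is compared with a tail of `a`
or `b`, none of which exceeds `b`, while `B` is `b` with its last digit raised. -/
lemma factor_lt_of_lt (e : BinSeq) {l : ℕ} (hl0 : 0 < l) (hl : l < N) {B : BinSeq}
    (hB : ∀ i, i + 1 < N → B i = b i) (hBl : B (N - 1) = true) :
    toLex (shift l (inflate N a b e)) < toLex B := by
  obtain ⟨h1, h2, h3⟩ := h.inflate_offset e hl0 hl
  set y := shift l (inflate N a b e) with hy
  have haN : a (N - l - 1 + l) = true := by rw [← h.a_last]; congr 1; omega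
  have hbN : b (N - l - 1 + l) = false := by rw [← h.b_last]; congr 1; omega
  cases e0 : e 0 <;> cases e1 : e 1 <;>
    simp only [e0, e1, cond_true, cond_false] at h1 h2 h3
  · refine h.lt_of_agree hB hBl (h.shift_b_le l) fun i hi => ?_
    rcases lt_trichotomy i (N - l - 1) with hi' | hi' | hi'
    · rw [h1 i hi']; rfl
    · rw [hi', h2, shift_apply, hbN]
    · rw [h3 i (by omega) hi]; rfl
  -- The delicate case: the last digit of the first block is raised from 0 to 1. Primitivity makes
  -- the tail of `b` strictly smaller than `b`; the position of the first difference relative to the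
  -- raised digit decides what remains.
  · have hne : shift l b ≠ b := fun he => by
      have := Nat.le_of_dvd hl0 (h.prim_b l he); omega
    obtain ⟨n, g1, g2, g3⟩ := lex_lt_iff.1 (lt_of_le_of_ne (h.shift_b_le l) fun he => hne (toLex_inj.1 he))
    rcases lt_trichotomy n (N - l - 1) with hn | hn | hn
    · refine lex_lt_iff.2 ⟨n, fun i hi => ?_, ?_, ?_⟩
      · rw [h1 i (by omega), hB i (by omega), ← g1 i hi]; rfl
      · rw [h1 n hn]; exact g2
      · rw [hB n (by omega), g3]
    · have hz : ∀ i < N - l, (fun i => if i < N - l then b i else a (i - (N - l))) i = b i :=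
        fun i hi => if_pos hi
      refine h.lt_of_agree (x := fun i => if i < N - l then b i else a (i - (N - l))) hB hBl ?_
        fun i hi => ?_
      · rw [lex_le_shift_iff hz]
        have : shift (N - l) (fun i => if i < N - l then b i else a (i - (N - l))) = a := by
          funext i; simp [shift]
        rw [this]
        exact h.le_shift_b _
      · rcases lt_trichotomy i (N - l - 1) with hi' | hi' | hi'
        · rw [h1 i hi', if_pos (by omega), ← g1 i (by omega)]; rfl
        · rw [hi', h2, if_pos (by omega), ← hn, g3]
        · rw [h3 i (by omega) hi, if_neg (by omega), ← h.per (i - (N - l))]; congr 1; omega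
    -- Here an end piece of `b` would also be an initial piece of it; maximality on both sides then
    -- gives `b` a period shorter than N.
    · exfalso
      have g4 : ∀ i < N - l, shift l b i = b i := fun i hi => g1 i (by omega)
      have g5 := (lex_le_shift_iff g4).1 (h.shift_b_le l)
      rw [shift_shift, Nat.add_sub_cancel' hl.le, shift_per h.b_per] at g5
      have g6 := toLex_inj.1 (le_antisymm g5 (h.shift_b_le (N - l)))
      have := Nat.le_of_dvd (by omega) (h.prim_b _ g6.symm)
      omega
  · refine lt_trans (lt_of_lt_of_le (lex_lt_iff.2 ⟨N - l - 1, fun i hi => ?_, h2, haN⟩ :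
      toLex y < toLex (shift l a)) (h.max l)) (h.b_lt hB hBl)
    rw [h1 i hi]; rfl
  · refine h.lt_of_agree hB hBl (h.max l) fun i hi => ?_
    rcases lt_trichotomy i (N - l - 1) with hi' | hi' | hi'
    · rw [h1 i hi']; rfl
    · rw [hi', h2, shift_apply, haN]
    · rw [h3 i (by omega) hi]; rfl

lemma factor_lt (e : BinSeq) {j : ℕ} (hj : ¬ N ∣ j) {B : BinSeq}
    (hB : ∀ i, i + 1 < N → B i = b i) (hBl : B (N - 1) = true) :
    toLex (shift j (inflate N a b e)) < toLex B := by
  rw [← Nat.div_add_mod j N, ← shift_shift, h.shift_inflate]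
  exact h.factor_lt_of_lt _ (Nat.pos_of_ne_zero fun h0 => hj (Nat.dvd_of_mod_eq_zero h0))
    (Nat.mod_lt _ h.pos) hB hBl

lemma lt_factor (e : BinSeq) {j : ℕ} (hj : ¬ N ∣ j) {B : BinSeq}
    (hB : ∀ i, i + 1 < N → B i = a i) (hBl : B (N - 1) = false) :
    toLex B < toLex (shift j (inflate N a b e)) := by
  rw [← flip_lt_iff, ← shift_flip, flip_inflate]
  exact h.flip.factor_lt _ hj (fun i hi => by simp [hB i hi]) (by simp [hBl])

lemma upperSeq_last : upperSeq N a b (N - 1) = true := by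
  rw [upperSeq, h.inflate_last]; rfl

lemma lowerSeq_last : lowerSeq N a b (N - 1) = false := by
  rw [lowerSeq, h.inflate_last]; rfl

lemma shift_upperSeq : shift N (upperSeq N a b) = a := by
  have := h.shift_inflate 1 (consSeq false fun _ => true)
  rw [Nat.mul_one] at this
  rw [upperSeq, this, shift_one_consSeq, h.inflate_ones]

lemma lowerSeq_le_shift (e : BinSeq) (k : ℕ) :
    toLex (lowerSeq N a b) ≤ toLex (shift k (inflate N a b e)) := by
  by_cases hk : N ∣ k
  · obtain ⟨m, rfl⟩ := hk
    rw [h.shift_inflate, lowerSeq]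
    cases hm : shift m e 0
    · exact (h.inflate_lt_of_head rfl hm).le
    · rw [h.inflate_le_iff (by rw [hm]; rfl), ← consSeq_shift_one (shift m e), hm, consSeq_le_iff]
      exact zeros_le _
  · exact (h.lt_factor e hk lowerSeq_first h.lowerSeq_last).le

end LyndonPair

/-! ### Products of Lyndon pairs -/

namespace LyndonPair
variable {N M : ℕ} {a b c d : BinSeq}

/-- The predecessor digit fed into `inflate` is the digit that periodicity would put there, so the
prefixed sequences are still tails of the pair. -/
lemma consSeq_eq_shift (g : LyndonPair M c d) :
    consSeq true c = shift (M - 1) c ∧ consSeq false d = shift (M - 1) d := by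
  have := g.pos
  constructor <;> funext i <;> cases i
  · simp [g.a_last]
  · simp only [consSeq_succ, shift_apply]; rw [← g.per]; congr 1; omega
  · simp [g.b_last]
  · simp only [consSeq_succ, shift_apply]; rw [← g.b_per]; congr 1; omega

/-- Extremality at block boundaries is inherited from (c, d) through monotonicity of `inflate`; at
all other positions `factor_lt` and `lt_factor` apply. -/
lemma mul (h : LyndonPair N a b) (g : LyndonPair M c d) :
    LyndonPair (N * M) (inflate N a b (consSeq true c)) (inflate N a b (consSeq false d)) := by
  have hN := h.pos
  have hM := g.pos
  obtain ⟨e1, e2⟩ := g.consSeq_eq_shift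
  have hf : ∀ i, i + 1 < N → inflate N a b (consSeq true c) i = a i := fun i hi => by
    rw [inflate_first _ i hi]; rfl
  have hl : inflate N a b (consSeq true c) (N - 1) = false := by
    rw [h.inflate_last]; exact g.a_first
  have hf' : ∀ i, i + 1 < N → inflate N a b (consSeq false d) i = b i := fun i hi => by
    rw [inflate_first _ i hi]; rfl
  have hl' : inflate N a b (consSeq false d) (N - 1) = true := by
    rw [h.inflate_last]; exact g.b_first
  have hNM : N * M - 1 + 1 = N * M := Nat.sub_add_cancel (Nat.mul_pos hN hM)
  refine ⟨Nat.mul_pos hN hM, ?_, ?_, ?_, ?_, ?_, ?_, ?_, ?_, ?_⟩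
  · intro i
    have := congrFun (h.shift_inflate M (consSeq true c)) i
    rw [shift_apply] at this
    rw [this, e1, shift_shift, add_comm, ← shift_shift, shift_per g.per]
  · rw [h.inflate_head]; rfl
  · rw [inflate_of_eq hN _ _ _ hNM, e1]
    show c (M + (M - 1)) = true
    rw [add_comm, g.per, g.a_last]
  · rw [h.inflate_head]; rfl
  · rw [inflate_of_eq hN _ _ _ hNM, e2]
    show d (M + (M - 1)) = false
    rw [add_comm, g.b_per, g.b_last]
  · intro k
    by_cases hk : N ∣ k
    · obtain ⟨m, rfl⟩ := hk
      rw [h.shift_inflate]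
      cases hm : shift m (consSeq true c) 0
      · exact (h.inflate_lt_of_head rfl hm).le
      · rw [h.inflate_le_iff (by rw [hm]; rfl), ← consSeq_shift_one (shift m _), hm,
          consSeq_le_iff, shift_shift, shift_succ_consSeq]
        exact g.min m
    · exact (h.lt_factor _ hk hf hl).le
  · intro k
    by_cases hk : N ∣ k
    · obtain ⟨m, rfl⟩ := hk
      rw [h.shift_inflate]
      cases hm : shift m (consSeq true c) 0
      · rw [h.inflate_le_iff (by rw [hm]; rfl), ← consSeq_shift_one (shift m _), hm,
          consSeq_le_iff, shift_shift, shift_succ_consSeq]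
        exact g.max m
      · exact (h.inflate_lt_of_head hm rfl).le
    · exact (h.factor_lt _ hk hf' hl').le
  · obtain ⟨j, hj⟩ := g.orbit
    refine ⟨N * j, ?_⟩
    rw [h.shift_inflate, e1, e2, hj, shift_shift, shift_shift, add_comm]
  · intro k hk
    by_cases hd : N ∣ k
    · obtain ⟨m, rfl⟩ := hd
      refine Nat.mul_dvd_mul_left N (g.prim m ?_)
      rw [h.shift_inflate] at hk
      funext i
      have := congrFun hk (N * (i + 1) - 1)
      have hi : N * (i + 1) - 1 + 1 = N * (i + 1) :=
        Nat.sub_add_cancel (Nat.mul_pos hN (by omega))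
      rw [inflate_of_eq hN _ _ _ hi, inflate_of_eq hN _ _ _ hi, consSeq_succ, shift_apply, show i + 1 + m = i + m + 1 by omega, consSeq_succ] at this
      exact this
    · have := h.lt_factor (consSeq true c) hd hf hl
      rw [hk] at this
      exact absurd this (lt_irrefl _)

/-- Associativity of the substitution. -/
lemma inflate_mul (h : LyndonPair N a b) (g : LyndonPair M c d) (e : BinSeq) :
    inflate (N * M) (inflate N a b (consSeq true c)) (inflate N a b (consSeq false d)) e =
      inflate N a b (consSeq (e 0) (inflate M c d e)) := by
  have hN := h.pos
  have hM := g.pos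
  funext i
  by_cases hi : N ∣ i + 1
  · obtain ⟨k, hk⟩ := hi
    have hk0 : k ≠ 0 := by rintro rfl; omega
    obtain ⟨k, rfl⟩ : ∃ l, k = l + 1 := Nat.exists_eq_succ_of_ne_zero hk0
    rw [inflate_of_eq hN _ _ _ hk, consSeq_succ]
    by_cases hM' : M ∣ k + 1
    · obtain ⟨l, hl⟩ := hM'
      rw [inflate_of_eq hM _ _ _ hl, inflate_of_eq (Nat.mul_pos hN hM) _ _ _
        (by rw [hk, hl, Nat.mul_assoc])]
    · have hd : ¬ N * M ∣ i + 1 := by rwa [hk, Nat.mul_dvd_mul_iff_left hN]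
      have hdiv : i / (N * M) = k / M := by
        rw [← Nat.div_div_eq_div_mul]
        congr 1
        refine Nat.div_eq_of_lt_le ?_ ?_
        · rw [Nat.mul_comm]; rw [Nat.mul_succ] at hk; omega
        · rw [Nat.mul_comm]; omega
      rw [inflate_of_not_dvd _ _ _ hd, inflate_of_not_dvd _ _ _ hM', hdiv,
        inflate_of_eq hN _ _ _ hk, inflate_of_eq hN _ _ _ hk]
      rfl
  · have hi' : ¬ N * M ∣ i + 1 := fun hd => hi ((Dvd.intro M rfl).trans hd)
    have hdiv : i / (N * M) = i / N / M := (Nat.div_div_eq_div_mul _ _ _).symm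
    simp only [inflate_of_not_dvd _ _ _ hi, inflate_of_not_dvd _ _ _ hi', hdiv]
    generalize i / N = m
    cases m with
    | zero =>
      simp only [Nat.zero_div, consSeq_zero]
      cases e 0 <;> rfl
    | succ m =>
      simp only [consSeq_succ]
      by_cases hm : M ∣ m + 1
      · obtain ⟨hc, hd⟩ := g.last_digit m hm
        obtain ⟨l, hl⟩ := hm
        rw [inflate_of_eq hM _ _ _ hl, hl, Nat.mul_div_cancel_left _ hM, hc, hd]
        cases e l <;> rfl
      · have : (m + 1) / M = m / M := by
          rw [Nat.succ_div, if_neg hm, add_zero]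
        rw [inflate_of_not_dvd _ _ _ hm, this]
        cases e (m / M) <;> rfl

lemma upperSeq_mul (h : LyndonPair N a b) (g : LyndonPair M c d) :
    upperSeq (N * M) (inflate N a b (consSeq true c)) (inflate N a b (consSeq false d)) =
      inflate N a b (consSeq false (upperSeq M c d)) :=
  h.inflate_mul g _

lemma lowerSeq_mul (h : LyndonPair N a b) (g : LyndonPair M c d) :
    lowerSeq (N * M) (inflate N a b (consSeq true c)) (inflate N a b (consSeq false d)) =
      inflate N a b (consSeq true (lowerSeq M c d)) :=
  h.inflate_mul g _

end LyndonPair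

/-! ### Desubstitution -/

namespace LyndonPair
variable {N : ℕ} {a b : BinSeq} (h : LyndonPair N a b)
include h

lemma shift_le_of_le {x : BinSeq} (hx : ∀ i < N, x i = upperSeq N a b i)
    (hle : toLex x ≤ toLex (upperSeq N a b)) : toLex (shift N x) ≤ toLex a := by
  have := (lex_le_shift_iff hx).1 hle
  rwa [h.shift_upperSeq] at this

/-- One step of the decoding automaton: the first N - 1 digits are forced, and the last one decides
on which side of the gap between `a` and `b` the next block starts. -/
lemma step_of_ge {x : BinSeq} (h1 : toLex b ≤ toLex x) (h2 : toLex x ≤ toLex (upperSeq N a b)) :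
    (x (N - 1) = false → toLex b ≤ toLex (shift N x)) ∧
      (x (N - 1) = true → toLex (shift N x) ≤ toLex a) := by
  have hpos := h.pos
  have hx := agree_upperSeq h1 h2
  constructor
  · intro hl
    have hag : ∀ i < N, b i = x i := fun i hi => by
      by_cases hi' : i + 1 < N
      · rw [hx i hi']
      · obtain rfl : i = N - 1 := by omega
        rw [hl, h.b_last]
    have := (lex_le_shift_iff hag).1 h1
    rwa [shift_per h.b_per] at this
  · intro hl
    refine h.shift_le_of_le (fun i hi => ?_) h2
    by_cases hi' : i + 1 < N
    · rw [hx i hi', upperSeq_first i hi']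
    · obtain rfl : i = N - 1 := by omega
      rw [hl, h.upperSeq_last]

lemma step_of_le {x : BinSeq} (h1 : toLex (lowerSeq N a b) ≤ toLex x) (h2 : toLex x ≤ toLex a) :
    (x (N - 1) = false → toLex b ≤ toLex (shift N x)) ∧
      (x (N - 1) = true → toLex (shift N x) ≤ toLex a) := by
  have := h.flip.step_of_ge (x := BetaHole.flip x) (flip_le_iff.2 h2)
    (by rw [← flip_lowerSeq]; exact flip_le_iff.2 h1)
  rw [shift_flip, flip_le_iff, flip_le_iff, flip_apply, Bool.not_eq_false', Bool.not_eq_true'] at this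
  exact this.symm

/-- A sequence whose tails lie between `S⁻𝕃(S)^∞` and `𝕃(S)⁺S^∞` is in the range of the
substitution if it is not strictly between `S^∞` and `𝕃(S)^∞`. -/
lemma exists_inflate {c : BinSeq} {p : Bool}
    (hV : ∀ k, toLex (lowerSeq N a b) ≤ toLex (shift k c))
    (hU : ∀ k, toLex (shift k c) ≤ toLex (upperSeq N a b))
    (h0 : p = false → toLex b ≤ toLex c) (h1 : p = true → toLex c ≤ toLex a) :
    ∃ e, e 0 = p ∧ c = inflate N a b e := by
  have hpos := h.pos
  -- Digit m ≥ 1 is read at the end of block m - 1; the initial state `p` supplies the missing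
  -- predecessor of the first block.
  set e : BinSeq := fun m => if m = 0 then p else c (N * m - 1) with he
  have inv : ∀ m, (e m = false → toLex b ≤ toLex (shift (N * m) c)) ∧
      (e m = true → toLex (shift (N * m) c) ≤ toLex a) := by
    intro m
    induction m with
    | zero => exact ⟨h0, h1⟩
    | succ m ih =>
      have e1 : e (m + 1) = shift (N * m) c (N - 1) := by
        simp only [he, shift_apply, Nat.mul_succ]
        rw [if_neg (by omega)]; congr 1; omega
      have e2 : shift (N * (m + 1)) c = shift N (shift (N * m) c) := by
        rw [shift_shift, Nat.mul_succ]
      rw [e1, e2]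
      cases hm : e m
      · exact h.step_of_ge (ih.1 hm) (hU _)
      · exact h.step_of_le (hV _) (ih.2 hm)
  refine ⟨e, rfl, ?_⟩
  funext i
  by_cases hi : N ∣ i + 1
  · obtain ⟨k, hk⟩ := hi
    have hk0 : k ≠ 0 := by rintro rfl; omega
    rw [inflate_of_eq hpos _ _ _ hk, he]
    simp only [if_neg hk0]
    congr 1; omega
  · have hlt : i % N + 1 < N := by
      have h1 := Nat.mod_lt i hpos
      by_contra hge
      refine hi ⟨i / N + 1, ?_⟩
      have := Nat.div_add_mod i N
      rw [Nat.mul_succ]; omega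
    have hsplit : i % N + N * (i / N) = i := Nat.mod_add_div i N
    have hc : c i = shift (N * (i / N)) c (i % N) := by rw [shift_apply, hsplit]
    rw [inflate_of_not_dvd _ _ _ hi]
    have ha := per_mul h.per (i / N) (i % N)
    have hb := per_mul h.b_per (i / N) (i % N)
    rw [hsplit] at ha hb
    cases hm : e (i / N)
    · rw [hc, agree_upperSeq ((inv _).1 hm) (hU _) _ hlt, ← hb]; rfl
    · rw [hc, agree_lowerSeq (hV _) ((inv _).2 hm) _ hlt, ← ha]; rfl

end LyndonPair

/-! ### Mechanical sequences -/

/-- The number of ones among the first `n` digits. -/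
def digitSum (c : BinSeq) (n : ℕ) : ℕ := ∑ i ∈ Finset.range n, (c i).toNat

lemma digitSum_succ (c : BinSeq) (n : ℕ) : digitSum c (n + 1) = digitSum c n + (c n).toNat :=
  Finset.sum_range_succ _ _

lemma digitSum_add (c : BinSeq) (m n : ℕ) :
    digitSum c (m + n) = digitSum c m + digitSum (shift m c) n := by
  induction n with
  | zero => rfl
  | succ n ih => rw [← add_assoc, digitSum_succ, digitSum_succ, ih, shift_apply, add_comm m n, add_assoc]

lemma digitSum_congr {c d : BinSeq} {n : ℕ} (h : ∀ i < n, c i = d i) :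
    digitSum c n = digitSum d n :=
  Finset.sum_congr rfl fun i hi => by rw [h i (Finset.mem_range.1 hi)]

lemma eq_of_digitSum {c d : BinSeq} (h : ∀ n, digitSum c n = digitSum d n) : c = d := by
  funext n
  have := h (n + 1)
  rw [digitSum_succ, digitSum_succ, h n] at this
  cases hc : c n <;> cases hd : d n <;> simp_all

/-- The mechanical sequence of slope `p/q` and intercept `θ/q`. -/
def mech (p q θ : ℕ) : BinSeq := fun i => decide ((i * p + θ) / q < ((i + 1) * p + θ) / q)

section mech
variable {p q : ℕ}

lemma mech_toNat (hq : 0 < q) (hpq : p ≤ q) (θ n : ℕ) :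
    ((n + 1) * p + θ) / q = (n * p + θ) / q + (mech p q θ n).toNat := by
  have h1 : (n * p + θ) / q ≤ ((n + 1) * p + θ) / q :=
    Nat.div_le_div_right (by rw [Nat.add_mul]; omega)
  have h2 : ((n + 1) * p + θ) / q ≤ (n * p + θ) / q + 1 := by
    rw [← Nat.add_div_right _ hq]
    exact Nat.div_le_div_right (by rw [Nat.add_mul]; omega)
  unfold mech
  by_cases h : (n * p + θ) / q < ((n + 1) * p + θ) / q
  · simp only [h, decide_true, Bool.toNat_true]; omega
  · simp only [h, decide_false, Bool.toNat_false]; omega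

lemma digitSum_mech (hpq : p ≤ q) {θ : ℕ} (hθ : θ < q) (n : ℕ) :
    digitSum (mech p q θ) n = (n * p + θ) / q := by
  induction n with
  | zero => simp [digitSum, Nat.div_eq_of_lt hθ]
  | succ n ih => rw [digitSum_succ, ih, mech_toNat (by omega) hpq]

lemma shift_mech (hq : 0 < q) (k θ : ℕ) :
    shift k (mech p q θ) = mech p q ((k * p + θ) % q) := by
  funext i
  have key : ∀ j, ((j + k) * p + θ) / q = (j * p + (k * p + θ) % q) / q + (k * p + θ) / q := by
    intro j
    rw [← Nat.add_mul_div_left _ _ hq]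
    congr 1
    have := Nat.mod_add_div (k * p + θ) q
    rw [Nat.add_mul]; omega
  simp only [shift_apply, mech]
  rw [show i + k + 1 = i + 1 + k by omega, key, key]
  simp only [Nat.add_lt_add_iff_right]

/-- Partial digit sums are floors, which grow with the intercept; a first difference in the wrong
direction would contradict this. -/
lemma mech_mono (hpq : p ≤ q) {θ θ' : ℕ} (h : θ ≤ θ') (h' : θ' < q) :
    toLex (mech p q θ) ≤ toLex (mech p q θ') := by
  rw [← lex_not_lt, lex_lt_iff]
  rintro ⟨n, h1, h2, h3⟩
  have e1 := digitSum_mech hpq h' (n + 1)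
  have e2 := digitSum_mech hpq (h.trans_lt h') (n + 1)
  rw [digitSum_succ] at e1 e2
  rw [h2, digitSum_congr h1] at e1
  rw [h3] at e2
  have : ((n + 1) * p + θ) / q ≤ ((n + 1) * p + θ') / q := Nat.div_le_div_right (by omega)
  simp only [Bool.toNat_true, Bool.toNat_false] at e1 e2
  omega

lemma exists_mul_mod_eq (hp : Nat.Coprime p q) (hq1 : 1 < q) :
    ∃ j, j * p % q = q - 1 := by
  obtain ⟨m, hm⟩ := Nat.exists_mul_mod_eq_one_of_coprime hp hq1
  refine ⟨m * (q - 1), ?_⟩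
  have h1 : p * m ≡ 1 [MOD q] := by rw [Nat.ModEq, Nat.mod_eq_of_lt hq1]; exact hm.2
  have h2 : m * (q - 1) * p ≡ q - 1 [MOD q] := by
    have := h1.mul_right (q - 1)
    rw [one_mul] at this
    convert this using 1; ring
  rw [Nat.ModEq, Nat.mod_eq_of_lt (by omega : q - 1 < q)] at h2
  exact h2

/-- Shifting only moves the intercept by multiples of p modulo q, so the orbit is ordered by
intercept: 0 gives the smallest element and q - 1, reached by coprimality, the largest. -/
lemma lyndonPair_mech (hp : 0 < p) (hpq : p < q) (hc : Nat.Coprime p q) :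
    LyndonPair q (mech p q 0) (mech p q (q - 1)) := by
  have hq : 0 < q := by omega
  have hsh : ∀ k, shift k (mech p q 0) = mech p q (k * p % q) := fun k => by
    rw [shift_mech hq, add_zero]
  refine ⟨hq, fun i => ?_, ?_, ?_, ?_, ?_, fun k => ?_, fun k => ?_, ?_, fun k hk => ?_⟩
  · have := congrFun (hsh q) i
    rwa [Nat.mul_mod_right] at this
  · simp [mech, Nat.div_eq_of_lt hpq]
  · simp only [mech, decide_eq_true_eq, add_zero, Nat.sub_add_cancel hq,
      Nat.mul_div_cancel_left p hq]
    rw [Nat.div_lt_iff_lt_mul hq, Nat.mul_comm p]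
    exact Nat.mul_lt_mul_of_pos_right (by omega) hp
  · simp only [mech, decide_eq_true_eq, zero_mul, zero_add, one_mul,
      Nat.div_eq_of_lt (by omega : q - 1 < q)]
    exact Nat.div_pos (by omega) hq
  · simp only [mech, decide_eq_false_iff_not, not_lt, Nat.sub_add_cancel hq]
    have h1 : (q * p + (q - 1)) / q = p := by
      rw [Nat.mul_add_div hq, Nat.div_eq_of_lt (by omega)]; rfl
    rw [h1, Nat.le_div_iff_mul_le hq]
    obtain ⟨r, rfl⟩ : ∃ r, q = r + 1 := ⟨q - 1, by omega⟩
    rw [Nat.add_sub_cancel, Nat.mul_add, Nat.mul_comm p r]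
    omega
  · rw [hsh]; exact mech_mono hpq.le (Nat.zero_le _) (Nat.mod_lt _ hq)
  · rw [hsh]
    have := Nat.mod_lt (k * p) hq
    exact mech_mono hpq.le (by omega) (by omega)
  · obtain ⟨j, hj⟩ := exists_mul_mod_eq hc (by omega)
    exact ⟨j, by rw [hsh, hj]⟩
  -- At n * p ≡ -1 any positive intercept already raises the floor, so a shift that fixes the
  -- sequence has intercept 0.
  · obtain ⟨n, hn⟩ := exists_mul_mod_eq hc (by omega)
    rw [hsh] at hk
    have h1 := digitSum_mech hpq.le (Nat.mod_lt (k * p) hq) n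
    rw [hk, digitSum_mech hpq.le hq n, add_zero] at h1
    have h2 := Nat.div_add_mod (n * p) q
    have h3 : k * p % q = 0 := by
      by_contra hne
      have : (n * p) / q + 1 ≤ (n * p + k * p % q) / q := by
        rw [Nat.le_div_iff_mul_le hq, Nat.add_mul, Nat.mul_comm (n * p / q)]
        omega
      omega
    exact hc.symm.dvd_of_dvd_mul_right (Nat.dvd_of_mod_eq_zero h3)

/-- Rigidity: the tails of `c` lie between the smallest and the largest mechanical sequence of
slope `p/q` only if `c` is one of these sequences. -/
lemma eq_shift_mech (hp : 0 < p) (hpq : p < q) (hc : Nat.Coprime p q) {c : BinSeq}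
    (h1 : ∀ k, toLex (mech p q 0) ≤ toLex (shift k c))
    (h2 : ∀ k, toLex (shift k c) ≤ toLex (mech p q (q - 1))) :
    ∃ j, c = shift j (mech p q 0) := by
  have hq : 0 < q := by omega
  -- Induction from the first difference: where the tail exceeds the smallest mechanical sequence it
  -- gains a one, which pays for the loss of at most 1 when floors are split.
  have lower : ∀ n k, n * p / q ≤ digitSum (shift k c) n := by
    intro n
    induction n using Nat.strong_induction_on with
    | _ n ih =>
      intro k
      by_cases hag : ∀ i < n, mech p q 0 i = shift k c i
      · rw [← digitSum_congr hag, digitSum_mech hpq.le hq, add_zero]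
      · push Not at hag
        obtain ⟨j, hj, hne⟩ := hag
        have hlt := lt_of_le_of_ne (h1 k) fun he => hne (congrFun (toLex_inj.1 he) j)
        obtain ⟨m, g1, g2, g3⟩ := lex_lt_iff.1 hlt
        have hm : m < n := by
          by_contra hm
          exact hne (g1 j (by omega))
        obtain ⟨r, rfl⟩ : ∃ r, n = m + 1 + r := ⟨n - (m + 1), by omega⟩
        have e1 := ih r (by omega) (k + (m + 1))
        have e2 := mech_toNat hq hpq.le 0 m
        rw [g2] at e2
        have e3 := digitSum_mech hpq.le hq m
        rw [digitSum_congr g1] at e3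
        rw [digitSum_add, digitSum_succ, g3, shift_shift, e3]
        have e4 : (m + 1 + r) * p / q ≤ (m + 1) * p / q + r * p / q + 1 := by
          rw [Nat.add_mul, Nat.add_div hq]
          split_ifs <;> omega
        simp only [Bool.toNat_true, Bool.toNat_false, add_zero] at *
        omega
  have upper : ∀ n k, digitSum (shift k c) n ≤ (n * p + (q - 1)) / q := by
    intro n
    induction n using Nat.strong_induction_on with
    | _ n ih =>
      intro k
      by_cases hag : ∀ i < n, shift k c i = mech p q (q - 1) i
      · rw [digitSum_congr hag, digitSum_mech hpq.le (by omega)]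
      · push Not at hag
        obtain ⟨j, hj, hne⟩ := hag
        have hlt := lt_of_le_of_ne (h2 k) fun he => hne (congrFun (toLex_inj.1 he) j)
        obtain ⟨m, g1, g2, g3⟩ := lex_lt_iff.1 hlt
        have hm : m < n := by
          by_contra hm
          exact hne (g1 j (by omega))
        obtain ⟨r, rfl⟩ : ∃ r, n = m + 1 + r := ⟨n - (m + 1), by omega⟩
        have e1 := ih r (by omega) (k + (m + 1))
        have e2 := mech_toNat hq hpq.le (q - 1) m
        rw [g3] at e2
        have e3 := digitSum_mech hpq.le (by omega : q - 1 < q) m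
        rw [← digitSum_congr g1] at e3
        rw [digitSum_add, digitSum_succ, g2, shift_shift, e3]
        have e4 : ((m + 1) * p + (q - 1)) / q + (r * p + (q - 1)) / q ≤
            ((m + 1 + r) * p + (q - 1)) / q + 1 := by
          rw [← Nat.add_div_right _ hq]
          refine Nat.div_add_div_le_add_div.trans (Nat.div_le_div_right ?_)
          rw [Nat.add_mul (m + 1) r]; omega
        simp only [Bool.toNat_true, Bool.toNat_false, add_zero] at *
        omega
  have hsum : ∀ k, digitSum (shift k c) q = p := by
    intro k
    have e1 := lower q k
    have e2 := upper q k
    rw [Nat.mul_div_cancel_left p hq] at e1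
    rw [Nat.mul_add_div hq, Nat.div_eq_of_lt (by omega : q - 1 < q)] at e2
    omega
  have hper : ∀ k, c (k + q) = c k := by
    intro k
    have e1 := hsum k
    have e2 := hsum (k + 1)
    have e3 := digitSum_add (shift k c) 1 q
    rw [add_comm 1 q, digitSum_succ, shift_shift, e1, e2] at e3
    have e4 : digitSum (shift k c) 1 = (c k).toNat := by simp [digitSum]
    rw [e4, shift_apply, add_comm q k] at e3
    cases hc1 : c (k + q) <;> cases hc2 : c k <;> simp_all
  -- The discrepancy from slope p/q. It has period q, hence attains a minimum; from there every
  -- prefix has at least ⌈np/q⌉ ones, the largest number allowed by `upper`, so that tail is the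
  -- largest mechanical sequence.
  set f : ℕ → ℤ := fun k => digitSum c k * q - k * p with hf
  have hfper : ∀ m k, f (k + q * m) = f k := by
    intro m
    induction m with
    | zero => simp
    | succ m ih =>
      intro k
      rw [← ih k, Nat.mul_succ, ← add_assoc]
      simp only [hf]
      rw [digitSum_add _ _ q, hsum]
      push_cast; ring
  obtain ⟨k₀, -, hk₀⟩ := Finset.exists_min_image (Finset.range q) f ⟨0, Finset.mem_range.2 hq⟩
  have hmin : ∀ k, f k₀ ≤ f k := by
    intro k
    rw [← Nat.mod_add_div k q, hfper]
    exact hk₀ _ (Finset.mem_range.2 (Nat.mod_lt _ hq))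
  have hk : shift k₀ c = mech p q (q - 1) := by
    refine eq_of_digitSum fun n => ?_
    rw [digitSum_mech hpq.le (by omega)]
    refine le_antisymm (upper n k₀) ?_
    have := hmin (k₀ + n)
    simp only [hf, digitSum_add] at this
    push_cast at this
    have h3 : (n * p : ℤ) ≤ digitSum (shift k₀ c) n * q := by linarith
    norm_cast at h3
    rw [← Nat.lt_succ_iff, Nat.div_lt_iff_lt_mul hq, Nat.succ_mul]
    omega
  obtain ⟨j, hj⟩ := exists_mul_mod_eq hc (by omega)
  have hj' : mech p q (q - 1) = shift j (mech p q 0) := by rw [shift_mech hq, add_zero, hj]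
  refine ⟨j + (q * k₀ - k₀), ?_⟩
  have hle : k₀ ≤ q * k₀ := Nat.le_mul_of_pos_left k₀ hq
  rw [← shift_shift, ← hj', ← hk, shift_shift, Nat.add_sub_cancel' hle]
  funext i
  rw [shift_apply, per_mul hper]

end mech

/-! ### Farey words -/

/-- `w` is the Christoffel word of slope `p/q`. -/
def IsChristoffel (w : Word) (p q : ℕ) : Prop :=
  0 < q ∧ p ≤ q ∧ Nat.Coprime p q ∧ w = (List.range q).map (mech p q 0)

/-- `v` and `w` are Christoffel words whose slopes are Farey neighbours. -/
def FareyNeighbours (v w : Word) : Prop :=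
  ∃ p q p' q', IsChristoffel v p q ∧ IsChristoffel w p' q' ∧ p' * q = p * q' + 1

/-- Passing from slope p/q to the mediant adds i / (q * (q + q')) < 1/q to a multiple of 1/q, so no
integer is crossed. -/
lemma mediant_div_left {p q p' q' : ℕ} (hq : 0 < q) (hn : p' * q = p * q' + 1) {i : ℕ}
    (hi : i < q + q') : i * (p + p') / (q + q') = i * p / q := by
  have h0 : 0 < q + q' := by omega
  apply le_antisymm
  · rw [Nat.le_div_iff_mul_le hq]
    have h1 := Nat.div_mul_le_self (i * (p + p')) (q + q')
    set m := i * (p + p') / (q + q')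
    by_contra hlt
    push Not at hlt
    nlinarith
  · rw [Nat.le_div_iff_mul_le h0]
    have h1 := Nat.div_mul_le_self (i * p) q
    set m := i * p / q
    refine Nat.le_of_mul_le_mul_left ?_ hq
    nlinarith

/-- The left quotient, before rounding, exceeds p + j * p' / q' by (q' - j) / (q' * (q + q')), which
lies in [0, 1/q'). -/
lemma mediant_div_right {p q p' q' : ℕ} (hq' : 0 < q') (hn : p' * q = p * q' + 1) {j : ℕ}
    (hj : j ≤ q') : (q + j) * (p + p') / (q + q') = p + j * p' / q' := by
  have h0 : 0 < q + q' := by omega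
  apply le_antisymm
  · rw [← Nat.lt_succ_iff, Nat.div_lt_iff_lt_mul h0]
    have h1 := Nat.lt_div_mul_add (a := j * p') hq'
    set m := j * p' / q'
    have h2 : j * p' + 1 ≤ m * q' + q' := h1
    have h3 : (j * p' + 1) * (q + q') ≤ (m * q' + q') * (q + q') := Nat.mul_le_mul_right _ h2
    refine Nat.lt_of_mul_lt_mul_left (a := q') ?_
    have h4 : (q + j) * (p + p') = p * (q + q') + 1 + j * (p + p') := by nlinarith
    rw [h4]
    have h5 : j * (p + p') * q' + j = j * p' * (q + q') := by nlinarith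
    nlinarith
  · rw [Nat.le_div_iff_mul_le h0]
    have h1 := Nat.div_mul_le_self (j * p') q'
    set m := j * p' / q'
    refine Nat.le_of_mul_le_mul_left ?_ hq'
    nlinarith

lemma FareyNeighbours.christoffel_append {v w : Word} {p q p' q' : ℕ} (hv : IsChristoffel v p q)
    (hw : IsChristoffel w p' q') (hn : p' * q = p * q' + 1) :
    IsChristoffel (v ++ w) (p + p') (q + q') := by
  obtain ⟨hq, hpq, hc, rfl⟩ := hv
  obtain ⟨hq', hpq', hc', rfl⟩ := hw
  refine ⟨by omega, by omega, ?_, ?_⟩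
  · have h1 := Nat.gcd_dvd_left (p + p') (q + q')
    have h2 := Nat.gcd_dvd_right (p + p') (q + q')
    have h3 : (p + p') * q = p * (q + q') + 1 := by nlinarith
    have h4 := h1.mul_right q
    rw [h3] at h4
    exact Nat.dvd_one.1 ((Nat.dvd_add_right (h2.mul_left p)).1 h4)
  · rw [List.range_add, List.map_append, List.map_map]
    congr 1
    · refine List.map_congr_left fun i hi => ?_
      rw [List.mem_range] at hi
      simp only [mech, add_zero]
      rw [mediant_div_left hq hn (by omega), mediant_div_left hq hn (by omega)]
    · refine List.map_congr_left fun j hj => ?_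
      rw [List.mem_range] at hj
      simp only [mech, add_zero, Function.comp_apply]
      rw [add_assoc, mediant_div_right hq' hn (by omega), mediant_div_right hq' hn (by omega)]
      simp only [Nat.add_lt_add_iff_left]

/-- The determinant 1 of neighbouring slopes survives the insertion of a mediant. -/
lemma isChain_fareyStep (l : List Word) (h : l.IsChain FareyNeighbours) :
    (fareyStep l).IsChain FareyNeighbours := by
  match l with
  | [] => simp [fareyStep]
  | [w] => simp [fareyStep]
  | w :: v :: l =>
    rw [List.isChain_cons_cons] at h
    have ih := isChain_fareyStep (v :: l) h.2
    obtain ⟨p, q, p', q', hw, hv, hn⟩ := h.1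
    have hm := FareyNeighbours.christoffel_append hw hv hn
    rw [fareyStep, List.isChain_cons_cons]
    refine ⟨⟨p, q, _, _, hw, hm, by nlinarith⟩, ?_⟩
    have hn2 : FareyNeighbours (w ++ v) v := ⟨_, _, p', q', hm, hv, by nlinarith⟩
    cases l with
    | nil => simpa [fareyStep] using hn2
    | cons u l =>
      rw [fareyStep] at ih ⊢
      exact List.isChain_cons_cons.2 ⟨hn2, ih⟩

lemma christoffel_fareyStep (l : List Word) (h : l.IsChain FareyNeighbours)
    (hl : ∀ w ∈ l, ∃ p q, IsChristoffel w p q) : ∀ w ∈ fareyStep l, ∃ p q, IsChristoffel w p q := by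
  match l with
  | [] => simp [fareyStep]
  | [w] => simpa [fareyStep] using hl
  | w :: v :: l =>
    rw [List.isChain_cons_cons] at h
    have ih := christoffel_fareyStep (v :: l) h.2 fun u hu => hl u (List.mem_cons_of_mem _ hu)
    obtain ⟨p, q, p', q', hw, hv, hn⟩ := h.1
    intro u hu
    rw [fareyStep, List.mem_cons, List.mem_cons] at hu
    rcases hu with rfl | rfl | hu
    · exact ⟨p, q, hw⟩
    · exact ⟨_, _, FareyNeighbours.christoffel_append hw hv hn⟩
    · exact ih u hu

lemma christoffel_fareyList (n : ℕ) : (fareyList n).IsChain FareyNeighbours ∧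
    ∀ w ∈ fareyList n, ∃ p q, IsChristoffel w p q := by
  induction n with
  | zero =>
    have h0 : IsChristoffel [false] 0 1 := ⟨by simp, by simp, by simp, by simp [mech]⟩
    have h1 : IsChristoffel [true] 1 1 := ⟨by simp, by simp, by simp, by simp [mech]⟩
    refine ⟨?_, ?_⟩
    · simp only [fareyList, Function.iterate_zero, id, List.isChain_cons_cons,
        List.isChain_singleton, and_true]
      exact ⟨0, 1, 1, 1, h0, h1, rfl⟩
    · intro w hw
      simp only [fareyList, Function.iterate_zero, id, List.mem_cons, List.not_mem_nil,
        or_false] at hw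
      rcases hw with rfl | rfl
      · exact ⟨_, _, h0⟩
      · exact ⟨_, _, h1⟩
  | succ n ih =>
    rw [fareyList, Function.iterate_succ_apply']
    exact ⟨isChain_fareyStep _ ih.1, christoffel_fareyStep _ ih.1 ih.2⟩

lemma exists_christoffel_of_mem_fareyStar {w : Word} (h : w ∈ fareyStar) :
    ∃ p q, 0 < p ∧ p < q ∧ Nat.Coprime p q ∧ w = (List.range q).map (mech p q 0) := by
  obtain ⟨⟨n, hn⟩, h0, h1⟩ := h
  obtain ⟨p, q, hq, hpq, hc, rfl⟩ := (christoffel_fareyList n).2 w hn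
  refine ⟨p, q, Nat.pos_of_ne_zero ?_, lt_of_le_of_ne hpq ?_, hc, rfl⟩
  · rintro rfl
    obtain rfl : q = 1 := by simpa using hc
    exact h0 (by simp [mech])
  · rintro rfl
    obtain rfl : p = 1 := by simpa using hc
    exact h1 (by simp [mech])

/-! ### Rotations of words -/

lemma periodic_apply {w : Word} {i : ℕ} (hi : i < w.length) : periodic w i = w[i] := by
  rw [periodic, Nat.mod_eq_of_lt hi, List.getD_eq_getElem _ _ hi]

lemma periodic_add_length (w : Word) (i : ℕ) : periodic w (i + w.length) = periodic w i := by
  simp [periodic]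

lemma periodic_rotate {w : Word} (hw : w ≠ []) (k : ℕ) :
    periodic (w.rotate k) = shift k (periodic w) := by
  have h0 : 0 < w.length := List.length_pos_of_ne_nil hw
  funext i
  have h1 : i % w.length < (w.rotate k).length := by
    rw [List.length_rotate]; exact Nat.mod_lt _ h0
  have h2 : (i + k) % w.length < w.length := Nat.mod_lt _ h0
  rw [shift_apply, periodic, periodic, List.length_rotate, List.getD_eq_getElem _ _ h1,
    List.getD_eq_getElem _ _ h2, List.getElem_rotate]
  simp only [Nat.mod_add_mod]

/-- Links the list order used in `maxRotation` with the order on sequences; for equal lengths the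
periodic extensions differ within one period. -/
lemma lt_of_periodic_lt {u v : Word} (hu : u ≠ []) (hl : u.length = v.length)
    (h : toLex (periodic u) < toLex (periodic v)) : u < v := by
  obtain ⟨n, h1, h2, h3⟩ := lex_lt_iff.1 h
  have h0 : 0 < u.length := List.length_pos_of_ne_nil hu
  have hn : n < u.length := by
    by_contra hn
    have := h1 (n % u.length) ((Nat.mod_lt _ h0).trans_le (not_lt.1 hn))
    have e1 : periodic u (n % u.length) = periodic u n := by simp [periodic]
    have e2 : periodic v (n % u.length) = periodic v n := by rw [hl]; simp [periodic]
    rw [e1, e2, h2, h3] at this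
    cases this
  rw [periodic_apply hn] at h2
  rw [periodic_apply (hl ▸ hn)] at h3
  refine List.lt_iff_exists.2 (Or.inr ⟨n, hn, hl ▸ hn, fun j hj => ?_, ?_⟩)
  · have := h1 j hj
    rwa [periodic_apply (by omega), periodic_apply (by omega)] at this
  · rw [h2, h3]; decide

lemma foldr_max_mem (l : List Word) : l.foldr max [] = [] ∨ l.foldr max [] ∈ l := by
  induction l with
  | nil => exact Or.inl rfl
  | cons u l ih =>
    rw [List.foldr_cons]
    rcases max_choice u (l.foldr max []) with h | h
    · rw [h]; exact Or.inr List.mem_cons_self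
    · rw [h]; exact ih.imp_right (List.mem_cons_of_mem _)

lemma le_foldr_max (l : List Word) (w : Word) (hw : w ∈ l) : w ≤ l.foldr max [] := by
  induction l with
  | nil => cases hw
  | cons u l ih =>
    rw [List.foldr_cons]
    rcases List.mem_cons.1 hw with rfl | h
    · exact le_max_left _ _
    · exact (ih h).trans (le_max_right _ _)

lemma exists_maxRotation_eq (w : Word) : ∃ k, maxRotation w = w.rotate k := by
  have : maxRotation w ∈ w.cyclicPermutations := by
    rcases foldr_max_mem w.cyclicPermutations with h | h
    · have h1 := le_foldr_max w.cyclicPermutations w (List.mem_cyclicPermutations_self w)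
      rw [h] at h1
      have h2 : w = [] := by
        cases w with
        | nil => rfl
        | cons x l => exact absurd h1 (by simp)
      subst h2
      simp [maxRotation]
    · exact h
  obtain ⟨k, hk⟩ := (List.mem_cyclicPermutations_iff.1 this).symm
  exact ⟨k, hk.symm⟩

lemma length_maxRotation (w : Word) : (maxRotation w).length = w.length := by
  obtain ⟨k, hk⟩ := exists_maxRotation_eq w
  rw [hk, List.length_rotate]

lemma rotate_le_maxRotation (w : Word) (k : ℕ) : w.rotate k ≤ maxRotation w :=
  le_foldr_max _ _ (List.mem_cyclicPermutations_iff.2 (List.IsRotated.symm ⟨k, rfl⟩))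

lemma exists_periodic_maxRotation {w : Word} (hw : w ≠ []) :
    ∃ k, periodic (maxRotation w) = shift k (periodic w) := by
  obtain ⟨k, hk⟩ := exists_maxRotation_eq w
  exact ⟨k, by rw [hk, periodic_rotate hw]⟩

lemma shift_le_periodic_maxRotation {w : Word} (hw : w ≠ []) (k : ℕ) :
    toLex (shift k (periodic w)) ≤ toLex (periodic (maxRotation w)) := by
  have hlen := length_maxRotation w
  have h0 : 0 < w.length := List.length_pos_of_ne_nil hw
  rw [← lex_not_lt, ← periodic_rotate hw]
  intro hlt
  refine absurd (rotate_le_maxRotation w k) (not_le.2 (lt_of_periodic_lt ?_ ?_ hlt))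
  · rw [← List.length_pos_iff, hlen]; exact h0
  · rw [hlen, List.length_rotate]

/-- The periodic sequence of the largest rotation is characterized as the largest tail. -/
lemma periodic_maxRotation_eq {w : Word} (hw : w ≠ []) {b : BinSeq}
    (h1 : ∃ j, b = shift j (periodic w))
    (h2 : ∀ k, toLex (shift k (periodic w)) ≤ toLex b) : periodic (maxRotation w) = b := by
  obtain ⟨j, rfl⟩ := h1
  obtain ⟨k, hk⟩ := exists_periodic_maxRotation hw
  refine toLex_inj.1 (le_antisymm ?_ (shift_le_periodic_maxRotation hw j))
  rw [hk]; exact h2 k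

/-! ### Lyndon words -/

/-- The word `S` and its largest rotation generate a Lyndon pair. -/
def IsLyndon (S : Word) : Prop :=
  LyndonPair S.length (periodic S) (periodic (maxRotation S))

/-- The substitution of the word `S` on sequences. -/
def inflateWord (S : Word) (e : BinSeq) : BinSeq :=
  inflate S.length (periodic S) (periodic (maxRotation S)) e

lemma isLyndon_of_pair {S : Word} {b : BinSeq} (h : LyndonPair S.length (periodic S) b) :
    IsLyndon S ∧ periodic (maxRotation S) = b := by
  have hb := periodic_maxRotation_eq (List.length_pos_iff.1 h.pos) h.orbit h.max
  exact ⟨by rw [IsLyndon, hb]; exact h, hb⟩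

lemma IsLyndon.ne_nil {S : Word} (h : IsLyndon S) : S ≠ [] := List.length_pos_iff.1 h.pos

lemma getD_dropLast_append {w : Word} (hw : w ≠ []) (x : Bool) (i : ℕ) (hi : i < w.length) :
    (w.dropLast ++ [x]).getD i false = if i + 1 = w.length then x else w.getD i false := by
  have h0 : 0 < w.length := List.length_pos_of_ne_nil hw
  have hlen : w.dropLast.length = w.length - 1 := List.length_dropLast
  split_ifs with h
  · rw [List.getD_append_right _ _ _ _ (by omega), hlen, show i - (w.length - 1) = 0 by omega]
    rfl
  · rw [List.getD_append _ _ _ _ (by omega), List.getD_eq_getElem _ _ (by omega),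
      List.getD_eq_getElem _ _ hi, List.getElem_dropLast]

lemma IsLyndon.length_block {S : Word} (h : IsLyndon S) (p d : Bool) :
    (block S p d).length = S.length := by
  have h0 := h.pos
  have h1 := length_maxRotation S
  cases p <;> cases d <;> simp [block, wordMinus, wordPlus] <;> omega

lemma IsLyndon.getD_block {S : Word} (h : IsLyndon S) (p d : Bool) (i : ℕ) (hi : i < S.length) :
    (block S p d).getD i false = if i + 1 = S.length then d else
      cond p (periodic S i) (periodic (maxRotation S) i) := by
  have h1 := length_maxRotation S
  have hne : maxRotation S ≠ [] := by rw [← List.length_pos_iff, h1]; exact h.pos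
  have e1 : periodic S i = S.getD i false := by rw [periodic, Nat.mod_eq_of_lt hi]
  have e2 : periodic (maxRotation S) i = (maxRotation S).getD i false := by
    rw [periodic, h1, Nat.mod_eq_of_lt hi]
  have hl : i + 1 = S.length → periodic S i = true ∧ periodic (maxRotation S) i = false :=
    fun he => h.last_digit i (by rw [he])
  cases p <;> cases d <;> simp only [block, wordMinus, wordPlus, cond_true, cond_false]
  · split_ifs with hh
    · rw [← e2, (hl hh).2]
    · rw [e2]
  · rw [getD_dropLast_append hne _ _ (h1.symm ▸ hi), h1, e2]
  · rw [getD_dropLast_append h.ne_nil _ _ hi, e1]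
  · split_ifs with hh
    · rw [← e1, (hl hh).1]
    · rw [e1]

/-- The substitution on words is a finite piece of `inflateWord`. The padding `t` is arbitrary,
since only the digits of `r` and their predecessor `p` are used. -/
lemma IsLyndon.substAux_spec {S : Word} (h : IsLyndon S) (t : BinSeq) (r : Word) (p : Bool) :
    (substAux S p r).length = S.length * r.length ∧
      ∀ i < S.length * r.length,
        (substAux S p r).getD i false = inflateWord S (consSeq p (appendSeq r t)) i := by
  induction r generalizing p with
  | nil => simp [substAux]
  | cons d r ih =>
    obtain ⟨ih1, ih2⟩ := ih d
    have hb := h.length_block p d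
    have hpos := h.pos
    refine ⟨by rw [substAux, List.length_append, hb, ih1, List.length_cons, Nat.mul_succ, add_comm],
      fun i hi => ?_⟩
    have happ : appendSeq (d :: r) t = consSeq d (appendSeq r t) := by
      funext j
      cases j with
      | zero => simp [appendSeq]
      | succ j => simp [appendSeq, consSeq]
    rw [substAux, happ]
    rw [List.length_cons, Nat.mul_succ] at hi
    by_cases hiS : i < S.length
    · rw [List.getD_append _ _ _ _ (by omega), h.getD_block p d i hiS]
      split_ifs with hl
      · obtain rfl : i = S.length - 1 := by omega
        rw [inflateWord, h.inflate_last]; rfl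
      · rw [inflateWord, inflate_first _ i (by omega)]; rfl
    · rw [List.getD_append_right _ _ _ _ (by omega), hb, ih2 _ (by omega)]
      have := congrFun (h.shift_inflate 1 (consSeq p (consSeq d (appendSeq r t)))) (i - S.length)
      rw [shift_apply, Nat.mul_one, Nat.sub_add_cancel (by omega), shift_one_consSeq] at this
      exact this.symm

lemma appendSeq_periodic (w : Word) : appendSeq w (periodic w) = periodic w := by
  funext i
  unfold appendSeq
  split_ifs with hi
  · rw [periodic_apply hi]
  · rw [← periodic_add_length w (i - w.length), Nat.sub_add_cancel (by omega)]

/-- A Lyndon word starts with 0, so its first digit has predecessor 1 and its largest rotation,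
starting with 1, has predecessor 0; this explains the two prefixed digits. -/
lemma IsLyndon.subst {S r : Word} (h : IsLyndon S) (g : IsLyndon r) :
    (subst S r).length = S.length * r.length ∧
      periodic (subst S r) = inflateWord S (consSeq true (periodic r)) ∧
      periodic (maxRotation (subst S r)) =
        inflateWord S (consSeq false (periodic (maxRotation r))) ∧ IsLyndon (subst S r) := by
  have hr : r.head? = some false := by
    have := g.a_first
    rw [periodic_apply g.pos] at this
    rw [List.head?_eq_getElem?, List.getElem?_eq_getElem g.pos, this]
  have hsub : BetaHole.subst S r = substAux S true r := by
    cases r with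
    | nil => simp at hr
    | cons d r =>
      simp only [List.head?_cons, Option.some.injEq] at hr
      subst hr; rfl
  obtain ⟨h1, h2⟩ := h.substAux_spec (periodic r) r true
  rw [appendSeq_periodic, ← hsub] at h2
  rw [← hsub] at h1
  have hm := h.mul g
  have hpos := hm.pos
  have hper : periodic (BetaHole.subst S r) = inflateWord S (consSeq true (periodic r)) := by
    funext i
    have hi := Nat.mod_lt i hpos
    rw [periodic, h1, h2 _ hi, inflateWord, ← per_mul hm.per (i / (S.length * r.length)),
      Nat.mod_add_div]
  have hpair : LyndonPair (BetaHole.subst S r).length (periodic (BetaHole.subst S r))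
      (inflateWord S (consSeq false (periodic (maxRotation r)))) := by
    rw [h1, hper]; exact hm
  exact ⟨h1, hper, (isLyndon_of_pair hpair).2, (isLyndon_of_pair hpair).1⟩

/-- The sequence `𝕃(S)⁺ S^∞` of the word `S`. -/
def upperWord (S : Word) : BinSeq := upperSeq S.length (periodic S) (periodic (maxRotation S))

/-- The sequence `S⁻ 𝕃(S)^∞` of the word `S`. -/
def lowerWord (S : Word) : BinSeq := lowerSeq S.length (periodic S) (periodic (maxRotation S))

lemma IsLyndon.appendSeq_wordPlus {S : Word} (h : IsLyndon S) :
    appendSeq (wordPlus (maxRotation S)) (periodic S) = upperWord S := by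
  have h1 := length_maxRotation S
  have hpos := h.pos
  have hne : maxRotation S ≠ [] := by rw [← List.length_pos_iff, h1]; exact hpos
  have hlen : (wordPlus (maxRotation S)).length = S.length := by
    simp [wordPlus, h1]; omega
  funext i
  simp only [appendSeq, hlen]
  split_ifs with hi
  · rw [← List.getD_eq_getElem _ false, wordPlus, getD_dropLast_append hne _ _ (h1.symm ▸ hi), h1]
    split_ifs with hl
    · obtain rfl : i = S.length - 1 := by omega
      exact h.upperSeq_last.symm
    · rw [upperWord, upperSeq_first i (by omega), periodic, h1, Nat.mod_eq_of_lt hi]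
  · have := congrFun h.shift_upperSeq (i - S.length)
    rw [shift_apply, Nat.sub_add_cancel (by omega)] at this
    exact this.symm

/-- The word `S` is rigid: only its own orbit lies between `S^∞` and `𝕃(S)^∞`. -/
def IsRigid (S : Word) : Prop :=
  ∀ c : BinSeq, (∀ k, toLex (periodic S) ≤ toLex (shift k c)) →
    (∀ k, toLex (shift k c) ≤ toLex (periodic (maxRotation S))) → ∃ j, c = shift j (periodic S)

lemma isLyndon_isRigid_of_mem_fareyStar {w : Word} (h : w ∈ fareyStar) : IsLyndon w ∧ IsRigid w := by
  obtain ⟨p, q, hp, hpq, hc, rfl⟩ := exists_christoffel_of_mem_fareyStar h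
  have hm := lyndonPair_mech hp hpq hc
  have hlen : ((List.range q).map (mech p q 0)).length = q := by simp
  have hper : periodic ((List.range q).map (mech p q 0)) = mech p q 0 := by
    funext i
    have hi := Nat.mod_lt i hm.pos
    rw [periodic, hlen, List.getD_eq_getElem _ _ (by rw [hlen]; exact hi), List.getElem_map,
      List.getElem_range, ← per_mul hm.per (i / q) (i % q), Nat.mod_add_div]
  rw [← hper] at hm
  have hm' : LyndonPair ((List.range q).map (mech p q 0)).length
    (periodic ((List.range q).map (mech p q 0))) (mech p q (q - 1)) := by rw [hlen]; exact hm
  obtain ⟨h1, h2⟩ := isLyndon_of_pair hm'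
  refine ⟨h1, fun c hc1 hc2 => ?_⟩
  rw [h2] at hc2
  rw [hper] at hc1 ⊢
  exact eq_shift_mech hp hpq hc hc1 hc2

/-! ### Comparison of the sequences attached to Lyndon words -/

lemma zeros_lt {c : BinSeq} {i : ℕ} (h : c i = true) :
    toLex (fun _ => false : BinSeq) < toLex c :=
  lt_of_le_of_ne (zeros_le c) fun he => by
    have := congrFun (toLex_inj.1 he) i
    simp [h] at this

lemma lt_ones {c : BinSeq} {i : ℕ} (h : c i = false) :
    toLex c < toLex (fun _ => true : BinSeq) :=
  lt_of_le_of_ne (le_ones c) fun he => by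
    have := congrFun (toLex_inj.1 he) i
    simp [h] at this

lemma inflateWord_ones {S : Word} (h : IsLyndon S) : inflateWord S (fun _ => true) = periodic S :=
  h.inflate_ones

lemma inflateWord_zeros {S : Word} (h : IsLyndon S) :
    inflateWord S (fun _ => false) = periodic (maxRotation S) :=
  h.inflate_zeros

lemma consSeq_const (p : Bool) : consSeq p (fun _ => p) = fun _ => p := by
  funext i; cases i <;> rfl

namespace IsLyndon
variable {S r : Word}

lemma upperWord_subst (h : IsLyndon S) (g : IsLyndon r) :
    upperWord (BetaHole.subst S r) = inflateWord S (consSeq false (upperWord r)) := by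
  obtain ⟨h1, h2, h3, -⟩ := h.subst g
  rw [upperWord, h1, h2, h3]
  exact h.upperSeq_mul g

lemma lowerWord_subst (h : IsLyndon S) (g : IsLyndon r) :
    lowerWord (BetaHole.subst S r) = inflateWord S (consSeq true (lowerWord r)) := by
  obtain ⟨h1, h2, h3, -⟩ := h.subst g
  rw [lowerWord, h1, h2, h3]
  exact h.lowerSeq_mul g

lemma periodic_eq_inflate (h : IsLyndon S) :
    periodic S = inflateWord S (consSeq true fun _ => true) := by
  rw [consSeq_const, inflateWord_ones h]

lemma maxRotation_eq_inflate (h : IsLyndon S) :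
    periodic (maxRotation S) = inflateWord S (consSeq false fun _ => false) := by
  rw [consSeq_const, inflateWord_zeros h]

lemma lowerWord_lt_periodic (h : IsLyndon S) : toLex (lowerWord S) < toLex (periodic S) := by
  rw [h.periodic_eq_inflate]
  exact h.inflate_cons_lt_iff.2 (lt_ones (i := 0) rfl)

lemma periodic_subst_lt (h : IsLyndon S) (g : IsLyndon r) :
    toLex (periodic (BetaHole.subst S r)) < toLex (periodic S) := by
  rw [(h.subst g).2.1, h.periodic_eq_inflate]
  exact h.inflate_cons_lt_iff.2 (lt_ones g.a_first)

lemma maxRotation_lt_subst (h : IsLyndon S) (g : IsLyndon r) :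
    toLex (periodic (maxRotation S)) < toLex (periodic (maxRotation (BetaHole.subst S r))) := by
  rw [(h.subst g).2.2.1, h.maxRotation_eq_inflate]
  exact h.inflate_cons_lt_iff.2 (zeros_lt g.b_first)

lemma lowerWord_length (h : IsLyndon S) : lowerWord S S.length = true := by
  have := congrFun (h.shift_inflate 1 (consSeq true fun _ => false)) 0
  rw [shift_one_consSeq, h.inflate_zeros, h.b_first, shift_apply, Nat.mul_one, zero_add] at this
  exact this

lemma upperWord_length (h : IsLyndon S) : upperWord S S.length = false := by
  have := congrFun h.shift_upperSeq 0
  rwa [shift_apply, zero_add, h.a_first] at this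

lemma lowerWord_lt_subst (h : IsLyndon S) (g : IsLyndon r) :
    toLex (lowerWord S) < toLex (lowerWord (BetaHole.subst S r)) := by
  rw [h.lowerWord_subst g]
  exact h.inflate_cons_lt_iff.2 (zeros_lt g.lowerWord_length)

lemma upperWord_subst_lt (h : IsLyndon S) (g : IsLyndon r) :
    toLex (upperWord (BetaHole.subst S r)) < toLex (upperWord S) := by
  rw [h.upperWord_subst g]
  exact h.inflate_cons_lt_iff.2 (lt_ones g.upperWord_length)

end IsLyndon

/-! ### Rigidity and disjointness -/

/-- If all tails of `d` lie between `d` and `𝕃(S)⁺S^∞`, then `d ≤ S^∞`. -/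
lemma IsRigid.le_periodic {S : Word} (hS : IsLyndon S) (hr : IsRigid S) {d : BinSeq}
    (h1 : ∀ k, toLex d ≤ toLex (shift k d)) (h2 : ∀ k, toLex (shift k d) ≤ toLex (upperWord S)) :
    toLex d ≤ toLex (periodic S) := by
  rw [← lex_not_lt]
  intro hlt
  -- If all tails stay below 𝕃(S)^∞, rigidity puts `d` in the orbit of S^∞, so S^∞ is a tail of `d`
  -- below `d`. Otherwise a tail above 𝕃(S)^∞ is decoded; its code contains a one, and the tail at
  -- that block is at most S^∞, again below `d`.
  by_cases hb : ∀ k, toLex (shift k d) ≤ toLex (periodic (maxRotation S))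
  · obtain ⟨j, hj⟩ := hr d (fun k => hlt.le.trans (h1 k)) hb
    have hle : j ≤ S.length * j := Nat.le_mul_of_pos_left j hS.pos
    have h3 := h1 (S.length * j - j)
    conv_rhs at h3 => rw [hj]
    rw [shift_shift, Nat.add_sub_cancel' hle, hS.shift_mul] at h3
    exact absurd h3 (not_le.2 hlt)
  · push Not at hb
    obtain ⟨k, hk⟩ := hb
    have hV : ∀ j, toLex (lowerWord S) ≤ toLex (shift j (shift k d)) := fun j => by
      rw [shift_shift]
      exact (hS.lowerWord_lt_periodic.le.trans hlt.le).trans (h1 _)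
    obtain ⟨e, he0, he⟩ := hS.exists_inflate (p := false) hV
      (fun j => by rw [shift_shift]; exact h2 _) (fun _ => hk.le) (fun h => by cases h)
    have hone : ∃ i, e i = true := by
      by_contra hne
      push Not at hne
      have : e = fun _ => false := funext fun i => by simpa using hne i
      rw [he, this, hS.inflate_zeros] at hk
      exact lt_irrefl _ hk
    obtain ⟨i, hi⟩ := hone
    have h3 := h1 (k + S.length * i)
    rw [← shift_shift, he, hS.shift_inflate] at h3
    have h4 : toLex (inflateWord S (shift i e)) ≤ toLex (periodic S) := by
      rw [← inflateWord_ones hS]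
      exact (hS.inflate_le_iff (by simpa using hi)).2 (le_ones _)
    exact absurd (h3.trans h4) (not_le.2 hlt)

lemma eq_of_periodic_eq {S S' : Word} (h : IsLyndon S) (h' : IsLyndon S')
    (he : periodic S = periodic S') : S = S' := by
  have hlen : S.length = S'.length := by
    apply Nat.dvd_antisymm
    · exact h.prim _ (by rw [he, shift_per h'.per])
    · exact h'.prim _ (by rw [← he, shift_per h.per])
  refine List.ext_getElem hlen fun i h1 h2 => ?_
  rw [← periodic_apply h1, ← periodic_apply h2, he]

/-- Lyndon intervals of distinct rigid words are disjoint. -/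
lemma IsRigid.eq_of_le_upperWord {S S' : Word} (h : IsLyndon S) (hr : IsRigid S)
    (h' : IsLyndon S') (hr' : IsRigid S')
    (h1 : toLex (periodic (maxRotation S')) ≤ toLex (upperWord S))
    (h2 : toLex (periodic (maxRotation S)) ≤ toLex (upperWord S')) : S = S' :=
  eq_of_periodic_eq h h' (toLex_inj.1 (le_antisymm
    (hr'.le_periodic h' h.min fun k => (h.max k).trans h2)
    (hr.le_periodic h h'.min fun k => (h'.max k).trans h1)))

lemma isLyndon_bullet {s : ℕ → Word} (hs : ∀ i, s i ∈ fareyStar) (n : ℕ) :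
    IsLyndon (bullet s n) := by
  induction n with
  | zero => exact (isLyndon_isRigid_of_mem_fareyStar (hs 0)).1
  | succ n ih => exact (ih.subst (isLyndon_isRigid_of_mem_fareyStar (hs (n + 1))).1).2.2.2

lemma bullet_congr {s s' : ℕ → Word} {n : ℕ} (h : ∀ i ≤ n, s i = s' i) :
    bullet s n = bullet s' n := by
  induction n with
  | zero => exact h 0 le_rfl
  | succ n ih =>
    rw [bullet, bullet, ih fun i hi => h i (by omega), h (n + 1) le_rfl]

/-! ### Symbolic Lyndon intervals and uniqueness of the coding. -/

/-- `A` lies in the symbolic Lyndon interval of `S`. -/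
def InLyndon (S : Word) (A : BinSeq) : Prop :=
  toLex (periodic (maxRotation S)) ≤ toLex A ∧ toLex A ≤ toLex (upperWord S)

lemma InLyndon.of_subst {S r : Word} {A : BinSeq} (h : IsLyndon S) (g : IsLyndon r)
    (hA : InLyndon (subst S r) A) : InLyndon S A :=
  ⟨(h.maxRotation_lt_subst g).le.trans hA.1, hA.2.trans (h.upperWord_subst_lt g).le⟩

/-- Once the first words agree, the common substitution cancels from the inequalities, and
disjointness for the rigid words `s (n + 1)` and `s' (n + 1)` remains. -/
lemma eq_of_inLyndon_bullet {s s' : ℕ → Word} (hs : ∀ i, s i ∈ fareyStar)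
    (hs' : ∀ i, s' i ∈ fareyStar) {A : BinSeq} {n : ℕ} (h : InLyndon (bullet s n) A)
    (h' : InLyndon (bullet s' n) A) : ∀ i ≤ n, s i = s' i := by
  induction n with
  | zero =>
    intro i hi
    obtain rfl : i = 0 := by omega
    obtain ⟨l, r⟩ := isLyndon_isRigid_of_mem_fareyStar (hs 0)
    obtain ⟨l', r'⟩ := isLyndon_isRigid_of_mem_fareyStar (hs' 0)
    exact r.eq_of_le_upperWord l l' r' (h'.1.trans h.2) (h.1.trans h'.2)
  | succ n ih =>
    obtain ⟨l, r⟩ := isLyndon_isRigid_of_mem_fareyStar (hs (n + 1))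
    obtain ⟨l', r'⟩ := isLyndon_isRigid_of_mem_fareyStar (hs' (n + 1))
    have hn := isLyndon_bullet hs n
    have ih := ih (h.of_subst hn l) (h'.of_subst (isLyndon_bullet hs' n) l')
    have hb := bullet_congr ih
    have h1 := h'.1.trans h.2
    have h2 := h.1.trans h'.2
    rw [bullet, bullet, ← hb, (hn.subst l').2.2.1, hn.upperWord_subst l] at h1
    rw [bullet, bullet, ← hb, (hn.subst l).2.2.1, hn.upperWord_subst l'] at h2
    intro i hi
    rcases Nat.lt_or_ge i (n + 1) with hi' | hi'
    · exact ih i (by omega)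
    · obtain rfl : i = n + 1 := by omega
      exact r.eq_of_le_upperWord l l' r' (hn.inflate_cons_le_iff.1 h1)
        (hn.inflate_cons_le_iff.1 h2)

/-- Bounds on the tails after a one (from below) and after a zero (from above) are bounds on all
tails behind the first occurrence of `10`. -/
lemma bounds_of_run {e x y : BinSeq} (h1 : ∀ m, e m = true → toLex x ≤ toLex (shift (m + 1) e))
    (h2 : ∀ m, e m = false → toLex (shift (m + 1) e) ≤ toLex y) {m₀ : ℕ} (hm : e m₀ = true)
    (hm' : e (m₀ + 1) = false) (hy : y 0 = true) (k : ℕ) :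
    toLex x ≤ toLex (shift (m₀ + 1 + k) e) ∧ toLex (shift (m₀ + 1 + k) e) ≤ toLex y := by
  induction k with
  | zero => exact ⟨h1 _ hm, (lex_lt_of_head (by simpa using hm') hy).le⟩
  | succ k ih =>
    have hs : shift (m₀ + 1 + (k + 1)) e = shift 1 (shift (m₀ + 1 + k) e) := by
      rw [shift_shift]; rfl
    cases hk : e (m₀ + 1 + k)
    · refine ⟨?_, h2 _ hk⟩
      rw [hs]
      exact ih.1.trans (le_shift_one_of_false (by simpa using hk))
    · refine ⟨h1 _ hk, ?_⟩
      rw [hs]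
      exact (shift_one_le_of_true (by simpa using hk)).trans ih.2

/-! ### Infinitely renormalizable sequences -/

/-- `A` is infinitely renormalizable along the Farey words `s`. -/
structure Renormalizable (s : ℕ → Word) (A : BinSeq) : Prop where
  farey : ∀ i, s i ∈ fareyStar
  mem : ∀ n, InLyndon (bullet s n) A

namespace Renormalizable
variable {s : ℕ → Word} {A : BinSeq} (H : Renormalizable s A)
include H

lemma lyndon (n : ℕ) : IsLyndon (bullet s n) := isLyndon_bullet H.farey n

lemma factor (n : ℕ) : IsLyndon (s n) := (isLyndon_isRigid_of_mem_fareyStar (H.farey n)).1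

lemma rigid (n : ℕ) : IsRigid (s n) := (isLyndon_isRigid_of_mem_fareyStar (H.farey n)).2

lemma length_bullet (n : ℕ) : n < (bullet s n).length := by
  induction n with
  | zero => exact (H.lyndon 0).pos
  | succ n ih =>
    have h1 := ((H.lyndon n).subst (H.factor (n + 1))).1
    have h2 := (H.factor (n + 1)).two_le
    rw [bullet, h1]
    nlinarith

lemma periodic_succ (n : ℕ) : periodic (bullet s (n + 1)) =
    inflateWord (bullet s n) (consSeq true (periodic (s (n + 1)))) :=
  ((H.lyndon n).subst (H.factor (n + 1))).2.1

lemma maxRotation_succ (n : ℕ) : periodic (maxRotation (bullet s (n + 1))) =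
    inflateWord (bullet s n) (consSeq false (periodic (maxRotation (s (n + 1))))) :=
  ((H.lyndon n).subst (H.factor (n + 1))).2.2.1

lemma upperWord_succ (n : ℕ) : upperWord (bullet s (n + 1)) =
    inflateWord (bullet s n) (consSeq false (upperWord (s (n + 1)))) :=
  (H.lyndon n).upperWord_subst (H.factor (n + 1))

lemma strictAnti_periodic : StrictAnti fun n => toLex (periodic (bullet s n)) :=
  strictAnti_nat_of_succ_lt fun n => (H.lyndon n).periodic_subst_lt (H.factor (n + 1))

lemma strictMono_lowerWord : StrictMono fun n => toLex (lowerWord (bullet s n)) :=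
  strictMono_nat_of_lt_succ fun n => (H.lyndon n).lowerWord_lt_subst (H.factor (n + 1))

lemma lowerWord_lt_periodic (n m : ℕ) :
    toLex (lowerWord (bullet s n)) < toLex (periodic (bullet s m)) :=
  ((H.strictMono_lowerWord.monotone (le_max_left n m)).trans_lt
    (H.lyndon _).lowerWord_lt_periodic).trans_le
    (H.strictAnti_periodic.antitone (le_max_right n m))

lemma maxRotation_lt (n : ℕ) : toLex (periodic (maxRotation (bullet s n))) < toLex A :=
  ((H.lyndon n).maxRotation_lt_subst (H.factor (n + 1))).trans_le (H.mem (n + 1)).1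

lemma digits (n : ℕ) : (∀ i, i + 1 < (bullet s n).length →
    A i = periodic (maxRotation (bullet s n)) i) ∧ A ((bullet s n).length - 1) = true := by
  have hn := H.lyndon n
  refine ⟨fun i hi => agree_upperSeq (H.mem n).1 (H.mem n).2 i hi, ?_⟩
  have hpos := hn.pos
  have h1 := (H.mem (n + 1)).1
  rw [H.maxRotation_succ] at h1
  rw [← hn.upperSeq_last]
  -- The last digit needs the next level: 𝕃(S_{n+1})^∞ already starts with 𝕃(S_n)⁺.
  refine agree_of_between (m := (bullet s n).length) (fun i hi => ?_) h1 (H.mem n).2 _ (by omega)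
  by_cases hi' : i + 1 < (bullet s n).length
  · rw [inflateWord, inflate_first _ i hi', upperWord, upperSeq_first i hi']; rfl
  · obtain rfl : i = (bullet s n).length - 1 := by omega
    rw [inflateWord, hn.inflate_last, upperWord, hn.upperSeq_last]
    exact (H.factor (n + 1)).b_first

lemma head : A 0 = true := by
  have h2 := (H.lyndon 0).two_le
  rw [(H.digits 0).1 0 (by omega), (H.lyndon 0).b_first]

lemma shift_periodic_lt (n k : ℕ) : toLex (shift k (periodic (bullet s n))) < toLex A :=
  ((H.lyndon n).max k).trans_lt (H.maxRotation_lt n)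

/-- Only boundaries with code digit 0 need a check: with code digit 1 the tail starts with 0, and
inside a block `factor_lt` applies because `A` starts with 𝕃(S_n)⁺. -/
lemma shift_inflateWord_lt (n : ℕ) {e : BinSeq}
    (he : ∀ m, e m = false → toLex (inflateWord (bullet s n) (shift m e)) < toLex A) (k : ℕ) :
    toLex (shift k (inflateWord (bullet s n) e)) < toLex A := by
  have hn := H.lyndon n
  by_cases hk : (bullet s n).length ∣ k
  · obtain ⟨m, rfl⟩ := hk
    rw [inflateWord, hn.shift_inflate]
    cases hm : e m
    · exact he m hm
    · refine lex_lt_of_head ?_ H.head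
      rw [hn.inflate_head, shift_apply, zero_add, hm]; rfl
  · exact hn.factor_lt e hk (H.digits n).1 (H.digits n).2

lemma shift_lowerWord_lt (n k : ℕ) : toLex (shift k (lowerWord (bullet s n))) < toLex A := by
  refine H.shift_inflateWord_lt n (fun m hm => ?_) k
  cases m with
  | zero => cases hm
  | succ m =>
    rw [shift_succ_consSeq]
    exact (inflateWord_zeros (H.lyndon n)).symm ▸ H.maxRotation_lt n

/-- A sequence that is the smallest of its tails, with tails below `A`, and that lies above all
`S_n⁻𝕃(S_n)^∞`, is some `S_m^∞` or lies below all of them. -/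
lemma eq_periodic_or_le {c : BinSeq} (h1 : ∀ k, toLex c ≤ toLex (shift k c))
    (h2 : ∀ k, toLex (shift k c) < toLex A)
    (h3 : ∀ n, toLex (lowerWord (bullet s n)) ≤ toLex c) (n : ℕ) :
    (∃ m, c = periodic (bullet s m)) ∨ toLex c ≤ toLex (periodic (bullet s n)) := by
  induction n with
  | zero =>
    exact Or.inr ((H.rigid 0).le_periodic (H.factor 0) h1 fun k => (h2 k).le.trans (H.mem 0).2)
  | succ n ih =>
    rcases ih with h | hle
    · exact Or.inl h
    have hn := H.lyndon n
    obtain ⟨e, he0, rfl⟩ := hn.exists_inflate (p := true) (fun k => (h3 n).trans (h1 k))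
      (fun k => (h2 k).le.trans (H.mem n).2) (fun h => by cases h) (fun _ => hle)
    by_cases hz : ∃ k, e k = false
    swap
    · push Not at hz
      refine Or.inl ⟨n, ?_⟩
      have he1 : e = fun _ => true := funext fun k => by simpa using hz k
      rw [he1]
      exact hn.inflate_ones
    refine Or.inr ?_
    have hlow : ∀ m, e m = true → toLex e ≤ toLex (shift m e) := fun m hm => by
      have := h1 ((bullet s n).length * m)
      rwa [hn.shift_inflate, hn.inflate_le_iff (by rw [shift_apply, zero_add, hm, he0])] at this
    -- Otherwise `e` starts with 11, while the tail at the end of its first run of ones starts with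
    -- 10 and is smaller.
    have he1 : e 1 = false := by
      by_contra hne
      rw [Bool.not_eq_false] at hne
      classical
      have hk := Nat.find_spec hz
      have hmin : ∀ m < Nat.find hz, e m = true := fun m hm => by simpa using Nat.find_min hz hm
      set k := Nat.find hz
      have hk0 : k ≠ 0 := fun h => by rw [h, he0] at hk; cases hk
      have hk1 : k - 1 + 1 = k := by omega
      refine absurd (hlow (k - 1) (hmin _ (by omega))) (lex_not_le.2 (lex_lt_iff.2
        ⟨1, fun i hi => ?_, by rw [shift_apply, add_comm, hk1, hk], hne⟩))
      obtain rfl : i = 0 := by omega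
      rw [shift_apply, zero_add, he0, hmin _ (by omega)]
    have hb := bounds_of_run (e := e) (x := shift 1 e) (y := upperWord (s (n + 1))) (m₀ := 0)
      (fun m hm => by
        have := hlow m hm
        have he := consSeq_shift_one e
        rw [he0] at he
        rwa [← consSeq_shift_succ _ m, hm, ← he, consSeq_le_iff] at this)
      (fun m hm => by
        have := (h2 ((bullet s n).length * m)).le.trans (H.mem (n + 1)).2
        rw [hn.shift_inflate, H.upperWord_succ, ← consSeq_shift_succ _ m, hm] at this
        exact hn.inflate_cons_le_iff.1 this)
      he0 he1 (by
        have := (H.factor (n + 1)).two_le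
        rw [upperWord, upperSeq_first 0 (by omega), (H.factor (n + 1)).b_first])
    -- Behind its leading 1 the code is again smallest among its tails, now bounded by the upper
    -- sequence of `s (n + 1)`: the same problem one level down.
    have hle' := (H.rigid (n + 1)).le_periodic (H.factor (n + 1)) (d := shift 1 e)
      (fun k => by rw [shift_shift]; simpa using (hb k).1)
      (fun k => by rw [shift_shift]; simpa using (hb k).2)
    rw [H.periodic_succ, ← consSeq_shift_one e, he0]
    exact hn.inflate_cons_le_iff.2 hle'

lemma exists_shift_eq_periodic_of_eq_shift {n : ℕ} {c : BinSeq} {j : ℕ}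
    (h : c = shift j (periodic (bullet s n))) : ∃ k, shift k c = periodic (bullet s n) := by
  have hn := H.lyndon n
  refine ⟨(bullet s n).length * j - j, ?_⟩
  rw [h, shift_shift, Nat.add_sub_cancel' (Nat.le_mul_of_pos_left j hn.pos), hn.shift_mul]

/-- A sequence with all tails above all `S_n⁻𝕃(S_n)^∞` and below `A` ends in some `S_m^∞` or in a
sequence of the range of the substitution of `S_n`. -/
lemma eventually_periodic_or_inflate {c : BinSeq}
    (hV : ∀ n k, toLex (lowerWord (bullet s n)) ≤ toLex (shift k c))
    (hA : ∀ k, toLex (shift k c) < toLex A) (n : ℕ) :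
    (∃ j m, shift j c = periodic (bullet s m)) ∨ ∃ j e, shift j c = inflateWord (bullet s n) e := by
  -- One tail outside the open gap between S_n^∞ and 𝕃(S_n)^∞ starts the decoding. If there is none,
  -- all tails are trapped in the gap and rigidity applies.
  have desubst : ∀ n, (∃ k, toLex (shift k c) ≤ toLex (periodic (bullet s n)) ∨
      toLex (periodic (maxRotation (bullet s n))) ≤ toLex (shift k c)) →
      ∃ j e, shift j c = inflateWord (bullet s n) e := by
    rintro n ⟨k, hk⟩
    have hV' : ∀ j, toLex (lowerWord (bullet s n)) ≤ toLex (shift j (shift k c)) := fun j => by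
      rw [shift_shift]; exact hV n _
    have hU' : ∀ j, toLex (shift j (shift k c)) ≤ toLex (upperWord (bullet s n)) := fun j => by
      rw [shift_shift]; exact (hA _).le.trans (H.mem n).2
    rcases hk with hk | hk
    · obtain ⟨e, -, he⟩ := (H.lyndon n).exists_inflate (p := true) hV' hU' (fun h => by cases h)
        fun _ => hk
      exact ⟨k, e, he⟩
    · obtain ⟨e, -, he⟩ := (H.lyndon n).exists_inflate (p := false) hV' hU' (fun _ => hk)
        fun h => by cases h
      exact ⟨k, e, he⟩
  induction n with
  | zero =>
    by_cases hk : ∃ k, toLex (shift k c) ≤ toLex (periodic (bullet s 0)) ∨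
        toLex (periodic (maxRotation (bullet s 0))) ≤ toLex (shift k c)
    · exact Or.inr (desubst 0 hk)
    · push Not at hk
      obtain ⟨j, hj⟩ := H.rigid 0 c (fun k => (hk k).1.le) fun k => (hk k).2.le
      obtain ⟨k, hk⟩ := H.exists_shift_eq_periodic_of_eq_shift (n := 0) hj
      exact Or.inl ⟨k, 0, hk⟩
  | succ n ih =>
    rcases ih with h | ⟨j, e, he⟩
    · exact Or.inl h
    by_cases hk : ∃ k, toLex (shift k c) ≤ toLex (periodic (bullet s (n + 1))) ∨
        toLex (periodic (maxRotation (bullet s (n + 1)))) ≤ toLex (shift k c)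
    · exact Or.inr (desubst _ hk)
    push Not at hk
    have hn := H.lyndon n
    have hc : ∀ m, shift (j + (bullet s n).length * m) c = inflateWord (bullet s n) (shift m e) :=
      fun m => by rw [← shift_shift, he]; exact hn.shift_inflate m e
    refine Or.inl ?_
    by_cases hrun : ∃ m, e m = true ∧ e (m + 1) = false
    · obtain ⟨m₀, hm, hm'⟩ := hrun
      have hb := bounds_of_run (e := e) (x := periodic (s (n + 1)))
        (y := periodic (maxRotation (s (n + 1)))) (m₀ := m₀)
        (fun m hm => by
          have := (hk (j + (bullet s n).length * m)).1.le
          rw [hc, H.periodic_succ, ← consSeq_shift_succ _ m, hm] at this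
          exact hn.inflate_cons_le_iff.1 this)
        (fun m hm => by
          have := (hk (j + (bullet s n).length * m)).2.le
          rw [hc, H.maxRotation_succ, ← consSeq_shift_succ _ m, hm] at this
          exact hn.inflate_cons_le_iff.1 this)
        hm hm' (H.factor (n + 1)).b_first
      obtain ⟨i, hi⟩ := H.rigid (n + 1) (shift (m₀ + 1) e)
        (fun k => by rw [shift_shift]; exact (hb k).1)
        (fun k => by rw [shift_shift]; exact (hb k).2)
      have hg := H.factor (n + 1)
      set M := (s (n + 1)).length with hM
      have hMpos : 0 < M := hg.pos
      have hle : i ≤ M * i := Nat.le_mul_of_pos_left i hMpos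
      -- The shift by M - 1 stops on the final 1 of a copy of `s (n + 1)`, the predecessor needed to
      -- recover S_{n+1}^∞ exactly.
      have hsh : shift (m₀ + 1 + (M * i - i) + (M - 1)) e = consSeq true (periodic (s (n + 1))) := by
        rw [add_assoc, ← shift_shift, hi, shift_shift, ← add_assoc, Nat.add_sub_cancel' hle,
          ← shift_shift, hg.shift_mul, hg.consSeq_eq_shift.1]
      exact ⟨_, n + 1, (hc _).trans (by rw [hsh, H.periodic_succ])⟩
    · push Not at hrun
      -- Without the factor 10 the code is constantly 1 after its first one, which gives S_n^∞, or
      -- constantly 0, which gives 𝕃(S_n)^∞, a rotation of it.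
      by_cases hone : ∃ i, e i = true
      · obtain ⟨i, hi⟩ := hone
        refine ⟨_, n, (hc i).trans ?_⟩
        rw [← inflateWord_ones hn]
        congr 1
        funext l
        induction l with
        | zero => simpa using hi
        | succ l ihl =>
          have := hrun _ ihl
          rw [shift_apply, add_right_comm]
          simpa using this
      · push Not at hone
        have he0 : e = fun _ => false := funext fun i => by simpa using hone i
        rw [he0, inflateWord_zeros hn] at he
        obtain ⟨i, hi⟩ := hn.orbit
        obtain ⟨k, hk'⟩ := H.exists_shift_eq_periodic_of_eq_shift (n := n) (he.trans hi)
        exact ⟨j + k, n, by rw [← shift_shift, hk']⟩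

end Renormalizable

/-! ### Hausdorff dimension of coded sets -/

lemma holderOnWith_of_dist {f : ℝ → ℝ} {s : Set ℝ} {K r : NNReal}
    (h : ∀ x ∈ s, ∀ y ∈ s, dist (f x) (f y) ≤ K * dist x y ^ (r : ℝ)) : HolderOnWith K r f s := by
  intro x hx y hy
  rw [edist_dist, edist_dist, ENNReal.ofReal_rpow_of_nonneg dist_nonneg r.coe_nonneg,
    ← ENNReal.ofReal_coe_nnreal, ← ENNReal.ofReal_mul K.coe_nonneg]
  exact ENNReal.ofReal_le_ofReal (h x hx y hy)

lemma rpow_logb_pow {D x : ℝ} (hD : 1 < D) (hx : 0 < x) (m : ℕ) :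
    (1 / D ^ m) ^ Real.logb D x = 1 / x ^ m := by
  have h0 : 0 < D := by linarith
  rw [Real.div_rpow zero_le_one (by positivity), Real.one_rpow, ← Real.rpow_pow_comm h0.le,
    Real.rpow_logb h0 hD.ne' hx]

/-- In base 3 with digits 0 and 1 a tail is at most 1/2, which leaves a gap of (1 - 1/2) / 3^(m+1).
-/
lemma proj_three_sub {e e' : BinSeq} {m : ℕ} (h : ∀ i < m, e i = e' i) (hne : e m ≠ e' m) :
    1 / 6 * (1 / 3 ^ m) ≤ |proj 3 e - proj 3 e'| := by
  have h3 : (1 : ℝ) < 3 := by norm_num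
  have main : ∀ {e e' : BinSeq}, (∀ i < m, e i = e' i) → e m = false → e' m = true →
      1 / 6 * (1 / 3 ^ m) ≤ proj 3 e' - proj 3 e := by
    intro e e' h h1 h2
    rw [proj_sub_eq h3 h h1 h2]
    have a1 := proj_nonneg h3 (shift (m + 1) e')
    have a2 := proj_le h3 (shift (m + 1) e)
    rw [pow_succ, div_mul_div_comm, div_le_div_iff₀ (by positivity) (by positivity)]
    have : (0 : ℝ) < 3 ^ m := by positivity
    nlinarith
  cases h1 : e m <;> cases h2 : e' m
  · exact absurd (h1.trans h2.symm) hne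
  · rw [abs_sub_comm]; exact (main h h1 h2).trans (le_abs_self _)
  · exact (main (fun i hi => (h i hi).symm) h2 h1).trans (le_abs_self _)
  · exact absurd (h1.trans h2.symm) hne

/-- Base 3 codes sequences injectively on the line with separated cylinders, so `f` becomes a Hölder
map with exponent log_3 D on a set of dimension at most 1. The constant log 3 is not sharp, but only
decay in D is needed. -/
lemma dimH_range_le {f : BinSeq → ℝ} {C D : ℝ} (hC : 0 ≤ C) (hD : 1 < D)
    (h : ∀ m e e', (∀ i < m, e i = e' i) → |f e - f e'| ≤ C / D ^ m) :
    dimH (range f) ≤ ENNReal.ofReal (Real.log 3 / Real.log D) := by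
  have hinj : Function.Injective (proj 3) := by
    intro e e' he
    by_contra hne
    obtain ⟨n, h1, h2⟩ := exists_first_diff hne
    have := proj_three_sub h1 h2
    rw [he, sub_self, abs_zero] at this
    have : (0 : ℝ) < 1 / 6 * (1 / 3 ^ n) := by positivity
    linarith
  have hr : 0 < Real.logb 3 D := Real.logb_pos (by norm_num) hD
  set r : NNReal := (Real.logb 3 D).toNNReal with hrdef
  have hrc : (r : ℝ) = Real.logb 3 D := Real.coe_toNNReal _ hr.le
  have hr0 : 0 < r := Real.toNNReal_pos.2 hr
  set K : NNReal := (C * 6 ^ Real.logb 3 D).toNNReal with hK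
  have hKc : (K : ℝ) = C * 6 ^ Real.logb 3 D := Real.coe_toNNReal _ (by positivity)
  set g : ℝ → ℝ := fun x => f (Function.invFun (proj 3) x) with hg
  have hgf : ∀ e, g (proj 3 e) = f e := fun e => by
    simp only [hg, Function.leftInverse_invFun hinj e]
  have hold : HolderOnWith K r g (range (proj 3)) := by
    refine holderOnWith_of_dist ?_
    rintro _ ⟨e, rfl⟩ _ ⟨e', rfl⟩
    rw [hgf, hgf, Real.dist_eq, Real.dist_eq, hKc, hrc]
    rcases eq_or_ne e e' with rfl | hne
    · simp only [sub_self, abs_zero]; positivity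
    obtain ⟨m, h1, h2⟩ := exists_first_diff hne
    have a1 := h m e e' h1
    have a2 := proj_three_sub h1 h2
    have a3 : 1 / 3 ^ m ≤ 6 * |proj 3 e - proj 3 e'| := by linarith
    have a4 := Real.rpow_le_rpow (by positivity) a3 hr.le
    rw [rpow_logb_pow (by norm_num) (by linarith), Real.mul_rpow (by norm_num) (abs_nonneg _)] at a4
    calc |f e - f e'| ≤ C * (1 / D ^ m) := by rw [mul_one_div]; exact a1
      _ ≤ C * (6 ^ Real.logb 3 D * |proj 3 e - proj 3 e'| ^ Real.logb 3 D) := by gcongr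
      _ = _ := by ring
  have himg : g '' range (proj 3) = range f := by
    rw [← range_comp]; congr 1; funext e; exact hgf e
  have hd := hold.dimH_image_le hr0
  rw [himg] at hd
  have h1 : dimH (range (proj 3)) ≤ 1 := by
    refine (dimH_mono (subset_univ _)).trans ?_
    rw [Real.dimH_of_mem_nhds (x := (0 : ℝ)) univ_mem]; simp
  refine hd.trans ((ENNReal.div_le_div_right h1 _).trans ?_)
  have : (r : ENNReal) = ENNReal.ofReal (Real.logb 3 D) := rfl
  rw [this, ← ENNReal.ofReal_one, ← ENNReal.ofReal_div_of_pos hr, Real.logb, one_div_div]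

/-- Decoding and then projecting in base 2 is Hölder on the range of `f` and covers [0,1); a set of
dimension zero could not have such an image. -/
lemma dimH_range_ne_zero {f : BinSeq → ℝ} {C D : ℝ} (hC : 0 < C) (hD : 1 < D)
    (h : ∀ m e e', (∀ i < m, e i = e' i) → e m = false → e' m = true →
      C / D ^ m ≤ f e' - f e) :
    dimH (range f) ≠ 0 := by
  have h0 : 0 < D := by linarith
  have habs : ∀ m e e', (∀ i < m, e i = e' i) → e m ≠ e' m → C / D ^ m ≤ |f e - f e'| := by
    intro m e e' h1 hne
    cases h2 : e m <;> cases h3 : e' m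
    · exact absurd (h2.trans h3.symm) hne
    · rw [abs_sub_comm]; exact (h m e e' h1 h2 h3).trans (le_abs_self _)
    · exact (h m e' e (fun i hi => (h1 i hi).symm) h3 h2).trans (le_abs_self _)
    · exact absurd (h2.trans h3.symm) hne
  have hinj : Function.Injective f := by
    intro e e' he
    by_contra hne
    obtain ⟨n, h1, h2⟩ := exists_first_diff hne
    have := habs n e e' h1 h2
    rw [he, sub_self, abs_zero] at this
    have : 0 < C / D ^ n := by positivity
    linarith
  have hr : 0 < Real.logb D 2 := Real.logb_pos hD (by norm_num)
  set r : NNReal := (Real.logb D 2).toNNReal with hrdef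
  have hrc : (r : ℝ) = Real.logb D 2 := Real.coe_toNNReal _ hr.le
  have hr0 : 0 < r := Real.toNNReal_pos.2 hr
  set K : NNReal := ((1 / C) ^ Real.logb D 2).toNNReal with hK
  have hKc : (K : ℝ) = (1 / C) ^ Real.logb D 2 := Real.coe_toNNReal _ (by positivity)
  set g : ℝ → ℝ := fun x => proj 2 (Function.invFun f x) with hg
  have hgf : ∀ e, g (f e) = proj 2 e := fun e => by
    simp only [hg, Function.leftInverse_invFun hinj e]
  have hold : HolderOnWith K r g (range f) := by
    refine holderOnWith_of_dist ?_
    rintro _ ⟨e, rfl⟩ _ ⟨e', rfl⟩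
    rw [hgf, hgf, Real.dist_eq, Real.dist_eq, hKc, hrc]
    rcases eq_or_ne e e' with rfl | hne
    · simp only [sub_self, abs_zero]; positivity
    obtain ⟨m, h1, h2⟩ := exists_first_diff hne
    have a1 := abs_proj_sub_le (β := 2) (by norm_num) h1
    rw [abs_sub_comm] at a1
    have a2 := habs m e e' h1 h2
    have a3 : 1 / D ^ m ≤ 1 / C * |f e - f e'| := by
      rw [one_div_mul_eq_div, le_div_iff₀ hC, mul_comm, mul_one_div]; exact a2
    have a4 := Real.rpow_le_rpow (by positivity) a3 hr.le
    rw [rpow_logb_pow hD (by norm_num), Real.mul_rpow (by positivity) (abs_nonneg _)] at a4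
    calc |proj 2 e - proj 2 e'| ≤ 1 / 2 ^ m := by
          refine a1.trans (le_of_eq ?_); norm_num
      _ ≤ _ := a4
  have himg : g '' range f = range (proj 2) := by
    rw [← range_comp]; congr 1; funext e; exact hgf e
  have hd := hold.dimH_image_le hr0
  rw [himg] at hd
  intro hz
  rw [hz, ENNReal.zero_div] at hd
  have h1 : dimH (Ico (0 : ℝ) 1) = 1 := by
    rw [Real.dimH_of_nonempty_interior ⟨1 / 2, by rw [interior_Ico]; constructor <;> norm_num⟩]; simp
  have h2 : Ico (0 : ℝ) 1 ⊆ range (proj 2) := fun x hx => by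
    obtain ⟨c, -, hc⟩ := exists_admissible (by norm_num) le_rfl hx
    exact ⟨c, hc⟩
  have h3 := (dimH_mono h2).trans hd
  rw [h1] at h3
  exact absurd h3 (by simp)

/-! ### Prefixed images of the substitution and sparse sequences. -/

lemma appendSeq_prefix (c : BinSeq) (j : ℕ) :
    appendSeq ((List.range j).map c) (shift j c) = c := by
  funext i
  by_cases hi : i < j
  · simp [appendSeq, hi]
  · simp [appendSeq, hi, Nat.sub_add_cancel (not_lt.1 hi)]

lemma appendSeq_agree (w : Word) {c d : BinSeq} {m : ℕ} (h : ∀ i < m, c i = d i) :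
    ∀ i < m, appendSeq w c i = appendSeq w d i := by
  intro i hi
  unfold appendSeq
  split_ifs
  · rfl
  · exact h _ (by omega)

/-- The range of the substitution of `S`, with a fixed prefix, has dimension at most
`log 3 / (|S| log β)`. -/
lemma dimH_inflateWord_le {β : ℝ} (hβ : 1 < β) {S : Word} (hS : S ≠ []) (w : Word) :
    dimH (range fun e => proj β (appendSeq w (inflateWord S e))) ≤
      ENNReal.ofReal (Real.log 3 / Real.log (β ^ S.length)) := by
  have hb : 0 < β - 1 := by linarith
  have h0 : 0 < β := by linarith
  have hN : S.length ≠ 0 := by simpa using hS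
  -- The factor β in the constant pays for the agreement being one digit short of |S| * m.
  refine dimH_range_le (C := β / (β - 1)) (by positivity) (one_lt_pow₀ hβ hN) ?_
  intro m e e' h
  have h1 : ∀ i < S.length * m - 1, inflateWord S e' i = inflateWord S e i := fun i hi =>
    inflate_agree (fun i hi => (h i hi).symm) (by omega)
  refine (abs_proj_sub_le hβ (appendSeq_agree w h1)).trans ?_
  rw [div_div, div_div, ← pow_mul, div_le_div_iff₀ (by positivity) (by positivity)]
  have : β ^ (S.length * m) ≤ β * β ^ (S.length * m - 1) := by
    rw [← pow_succ']
    exact pow_le_pow_right₀ hβ.le (by omega)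
  nlinarith

/-- The sequence `e` with `M` zeros inserted behind each digit. -/
def spread (M : ℕ) (e : BinSeq) : BinSeq := fun i =>
  if M + 1 ∣ i then e (i / (M + 1)) else false

lemma spread_mul (M : ℕ) (e : BinSeq) (m : ℕ) : spread M e ((M + 1) * m) = e m := by
  rw [spread, if_pos (Dvd.intro m rfl), Nat.mul_div_cancel_left _ (Nat.succ_pos M)]

lemma spread_agree {M m : ℕ} {e e' : BinSeq} (h : ∀ i < m, e i = e' i) :
    ∀ i < (M + 1) * m, spread M e i = spread M e' i := by
  intro i hi
  unfold spread
  rw [h _ (Nat.div_lt_of_lt_mul hi)]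

/-- A tail starts with 0, or with 1 followed by M zeros, whereas `d` starts with 1 and has a second
1 at some position up to M. -/
lemma shift_spread_lt {M : ℕ} {d : BinSeq} (h0 : d 0 = true) (hM : d M = true) (hM0 : M ≠ 0)
    (e : BinSeq) (k : ℕ) : toLex (shift k (spread M e)) < toLex d := by
  cases hk : spread M e k
  · exact lex_lt_of_head (by simpa using hk) h0
  · have hdvd : M + 1 ∣ k := by
      by_contra hne
      rw [spread, if_neg hne] at hk; cases hk
    classical
    have hex : ∃ p, p ≠ 0 ∧ d p = true := ⟨M, hM0, hM⟩
    have hle : Nat.find hex ≤ M := Nat.find_min' hex ⟨hM0, hM⟩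
    have hzero : ∀ i ≠ 0, i ≤ M → shift k (spread M e) i = false := fun i hi hiM => by
      have : ¬ M + 1 ∣ i + k := fun hd => by
        have := Nat.le_of_dvd (by omega) ((Nat.dvd_add_left hdvd).1 hd); omega
      rw [shift_apply, spread, if_neg this]
    refine lex_lt_iff.2 ⟨Nat.find hex, fun i hi => ?_, hzero _ (Nat.find_spec hex).1 hle,
      (Nat.find_spec hex).2⟩
    rcases eq_or_ne i 0 with rfl | hi0
    · rw [h0, shift_apply, zero_add, hk]
    · rw [hzero i hi0 (by omega)]
      have := Nat.find_min hex hi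
      cases hd : d i
      · rfl
      · exact absurd ⟨hi0, hd⟩ this

/-! ### From intervals of bases to the Farey sequence of β. -/

/-- The intervals of bases and the symbolic intervals correspond. -/
lemma inLyndon_of_mem {β : ℝ} {S : Word} (hS : IsLyndon S) (h : β ∈ lyndonInterval S)
    {A : BinSeq} (hA : QuasiGreedyTails β A) : InLyndon S A := by
  obtain ⟨βl, hl, βr, hr, hql, hqr, h1, h2⟩ := h
  rw [hS.appendSeq_wordPlus] at hqr
  exact ⟨(hql.tails hl.1 hl.2).mono hl.1 h1 hA,
    hA.mono (hl.1.trans_le h1) h2 (hqr.tails hr.1 hr.2)⟩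

lemma mem_Ioc_of_mem_lyndonInterval {β : ℝ} {S : Word} (h : β ∈ lyndonInterval S) :
    β ∈ Ioc (1 : ℝ) 2 := by
  obtain ⟨βl, hl, βr, hr, -, -, h1, h2⟩ := h
  exact ⟨hl.1.trans_le h1, h2.trans hr.2⟩

/-- Every infinitely renormalizable base has a unique sequence of Farey words. -/
lemma existsUnique_fareySequence {β : ℝ} (hβ : β ∈ infRenormalizable) :
    ∃! s : ℕ → Word, IsFareySequence β s := by
  have hmem : ∀ n, ∃ s : ℕ → Word, (∀ i, s i ∈ fareyStar) ∧ β ∈ lyndonInterval (bullet s n) := by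
    intro n
    obtain ⟨S, ⟨s, hs, rfl⟩, hS⟩ := mem_iUnion₂.1 (mem_iInter.1 hβ n)
    exact ⟨s, hs, hS⟩
  choose s hs hS using hmem
  obtain ⟨h1, h2⟩ := mem_Ioc_of_mem_lyndonInterval (hS 0)
  obtain ⟨A, hA⟩ := exists_quasiGreedyTails h1 h2
  have hin : ∀ n, InLyndon (bullet (s n) n) A := fun n =>
    inLyndon_of_mem (isLyndon_bullet (hs n) n) (hS n) hA
  have hdown : ∀ n m, n ≤ m → InLyndon (bullet (s m) n) A := by
    intro n m hnm
    obtain ⟨k, rfl⟩ := Nat.exists_eq_add_of_le hnm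
    suffices ∀ j ≤ k, InLyndon (bullet (s (n + k)) (n + k - j)) A by
      simpa using this k le_rfl
    intro j
    induction j with
    | zero => intro _; exact hin _
    | succ j ih =>
      intro hj
      have := ih (by omega)
      rw [show n + k - j = n + k - (j + 1) + 1 by omega, bullet] at this
      exact this.of_subst (isLyndon_bullet (hs _) _)
        (isLyndon_isRigid_of_mem_fareyStar (hs _ _)).1
  have hb : ∀ n, bullet (fun i => s i i) n = bullet (s n) n := fun n =>
    bullet_congr fun i hi =>
      eq_of_inLyndon_bullet (hs i) (hs n) (hin i) (hdown i n hi) i le_rfl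
  -- The witnesses for different depths agree on common indices, so the diagonal is a coherent
  -- sequence.
  refine ⟨fun i => s i i, ⟨fun i => hs i i, fun n => by rw [hb]; exact hS n⟩, ?_⟩
  rintro s' ⟨hs', hS'⟩
  funext i
  exact eq_of_inLyndon_bullet hs' (hs i) (inLyndon_of_mem (isLyndon_bullet hs' i) (hS' i) hA)
    (hin i) i le_rfl

/-! ### The critical value of an infinitely renormalizable base -/

section main
variable {β : ℝ} {s : ℕ → Word} {A : BinSeq}

/-- The point with greedy expansion `(s₁ • ⋯ • s_{n+1})^∞`. -/
noncomputable def bulletPoint (β : ℝ) (s : ℕ → Word) (n : ℕ) : ℝ := proj β (periodic (bullet s n))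

/-- The projection of `S_n⁻𝕃(S_n)^∞`. -/
noncomputable def lowerPoint (β : ℝ) (s : ℕ → Word) (n : ℕ) : ℝ := proj β (lowerWord (bullet s n))

/-- The limit of the points `bulletPoint β s n`. -/
noncomputable def limitPoint (β : ℝ) (s : ℕ → Word) : ℝ := ⨅ n, bulletPoint β s n

variable (hβ : 1 < β) (hβ2 : β ≤ 2) (hA : QuasiGreedyTails β A) (H : Renormalizable s A)
include hβ

lemma limitPoint_le (n : ℕ) : limitPoint β s ≤ bulletPoint β s n :=
  ciInf_le ⟨0, by rintro _ ⟨n, rfl⟩; exact proj_nonneg hβ _⟩ n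

include hA H

lemma admissible_periodic (n : ℕ) : Admissible β (periodic (bullet s n)) :=
  (hA.admissible_iff hβ _).2 (H.shift_periodic_lt n)

lemma admissible_lowerWord (n : ℕ) : Admissible β (lowerWord (bullet s n)) :=
  (hA.admissible_iff hβ _).2 (H.shift_lowerWord_lt n)

lemma strictAnti_bulletPoint : StrictAnti (bulletPoint β s) := fun _ m hnm =>
  (admissible_periodic hβ hA H m).proj_lt hβ (H.strictAnti_periodic hnm)

lemma limitPoint_lt (n : ℕ) : limitPoint β s < bulletPoint β s n :=
  (limitPoint_le hβ (n + 1)).trans_lt (strictAnti_bulletPoint hβ hA H (Nat.lt_succ_self n))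

lemma lowerPoint_le (n : ℕ) : lowerPoint β s n ≤ limitPoint β s :=
  le_ciInf fun m => (admissible_lowerWord hβ hA H n).proj_le hβ (H.lowerWord_lt_periodic n m).le

omit hA in
lemma lowerPoint_pos (n : ℕ) : 0 < lowerPoint β s n :=
  proj_pos_of_digit hβ (H.lyndon n).lowerWord_length

lemma tendsto_bulletPoint : Tendsto (bulletPoint β s) atTop (𝓝 (limitPoint β s)) :=
  tendsto_atTop_ciInf (strictAnti_bulletPoint hβ hA H).antitone
    ⟨0, by rintro _ ⟨n, rfl⟩; exact proj_nonneg hβ _⟩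

/-- Sequences that share the first `|S_n| - 1` digits with `S_n^∞` project close to the limit. -/
lemma tendsto_of_agree {c : ℕ → BinSeq}
    (hc : ∀ n i, i + 1 < (bullet s n).length → c n i = periodic (bullet s n) i) :
    Tendsto (fun n => proj β (c n)) atTop (𝓝 (limitPoint β s)) := by
  have h0 : 0 < β := by linarith
  have hb : 0 < β - 1 := by linarith
  have hl : Tendsto (fun n : ℕ => 1 / (β - 1) / β ^ n) atTop (𝓝 0) :=
    tendsto_const_nhds.div_atTop (tendsto_pow_atTop_atTop_of_one_lt hβ)
  have hd : Tendsto (fun n => proj β (c n) - bulletPoint β s n) atTop (𝓝 0) := by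
    refine squeeze_zero_norm (fun n => ?_) hl
    have := H.length_bullet n
    exact abs_proj_sub_le hβ fun i hi => (hc n i (by omega)).symm
  simpa using hd.add (tendsto_bulletPoint hβ hA H)

lemma tendsto_lowerPoint : Tendsto (lowerPoint β s) atTop (𝓝 (limitPoint β s)) :=
  tendsto_of_agree hβ hA H fun _ i hi => lowerSeq_first i hi

lemma tendsto_withZeros :
    Tendsto (fun n => proj β (withZeros (bullet s n))) atTop (𝓝 (limitPoint β s)) := by
  refine tendsto_of_agree hβ hA H fun n i hi => ?_
  have hi' : i < (bullet s n).length := by omega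
  rw [periodic_apply hi', withZeros, appendSeq, dif_pos hi']

lemma bulletPoint_mem_bifurcationSet (n : ℕ) : bulletPoint β s n ∈ bifurcationSet β := by
  have hadm := admissible_periodic hβ hA H n
  refine (mem_bifurcationSet_iff hβ).2 ⟨⟨proj_nonneg hβ _, hadm 0⟩, fun k => ?_⟩
  rw [bulletPoint, hadm.betaMap_iterate hβ]
  exact hadm.proj_le hβ ((H.lyndon n).min k)

include hβ2

lemma bifurcationSet_inter_eq :
    bifurcationSet β ∩ Ioo (limitPoint β s) 1 = range (bulletPoint β s) := by
  apply Subset.antisymm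
  · rintro t ⟨ht, hτ, -⟩
    obtain ⟨hmem, hmin⟩ := (mem_bifurcationSet_iff hβ).1 ht
    obtain ⟨c, hc, rfl⟩ := exists_admissible hβ hβ2 hmem
    have h1 : ∀ k, toLex c ≤ toLex (shift k c) := fun k => by
      refine (hc.shift k).lex_le_of_proj_le hβ ?_
      have := hmin k
      rwa [hc.betaMap_iterate hβ] at this
    have h3 : ∀ n, toLex (lowerWord (bullet s n)) ≤ toLex c := fun n =>
      hc.lex_le_of_proj_le hβ ((lowerPoint_le hβ hA H n).trans hτ.le)
    -- Lying below every S_n^∞ would put the point at or below the limit, so `c` must be one of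
    -- these sequences.
    have key := H.eq_periodic_or_le h1 ((hA.admissible_iff hβ c).1 hc) h3
    by_cases hex : ∃ m, c = periodic (bullet s m)
    · obtain ⟨m, rfl⟩ := hex
      exact ⟨m, rfl⟩
    · refine absurd hτ (not_lt.2 (le_ciInf fun n => ?_))
      exact hc.proj_le hβ ((key n).resolve_left hex)
  · rintro _ ⟨n, rfl⟩
    exact ⟨bulletPoint_mem_bifurcationSet hβ hA H n, limitPoint_lt hβ hA H n,
      admissible_periodic hβ hA H n 0⟩

/-- There are countably many finite prefixes and countably many S_m^∞, so the dimension is governed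
by the images under Φ_{S_n}. -/
lemma dimH_survivor_limitPoint_le (n : ℕ) : dimH (survivor β (limitPoint β s)) ≤
    ENNReal.ofReal (Real.log 3 / Real.log (β ^ (bullet s n).length)) := by
  set P : Set ℝ := range fun x : Word × ℕ => proj β (appendSeq x.1 (periodic (bullet s x.2)))
    with hP
  set Q : Word → Set ℝ := fun w =>
    range fun e => proj β (appendSeq w (inflateWord (bullet s n) e)) with hQ
  have hsub : survivor β (limitPoint β s) ⊆ P ∪ ⋃ w, Q w := by
    intro x hx
    obtain ⟨c, hc, rfl, hmin⟩ := (mem_survivor_iff hβ hβ2).1 hx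
    have hV : ∀ n k, toLex (lowerWord (bullet s n)) ≤ toLex (shift k c) := fun n k =>
      (hc.shift k).lex_le_of_proj_le hβ ((lowerPoint_le hβ hA H n).trans (hmin k))
    rcases H.eventually_periodic_or_inflate hV ((hA.admissible_iff hβ c).1 hc) n with
      ⟨j, m, h⟩ | ⟨j, e, h⟩
    · refine Or.inl ⟨((List.range j).map c, m), ?_⟩
      simp only [← h, appendSeq_prefix]
    · refine Or.inr (mem_iUnion.2 ⟨(List.range j).map c, e, ?_⟩)
      simp only [← h, appendSeq_prefix]
  refine (dimH_mono hsub).trans ?_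
  rw [dimH_union, dimH_countable (countable_range _), dimH_iUnion]
  exact max_le zero_le (iSup_le fun w => dimH_inflateWord_le hβ (H.lyndon n).ne_nil w)

lemma dimH_survivor_limitPoint : dimH (survivor β (limitPoint β s)) = 0 := by
  have hlog : 0 < Real.log β := Real.log_pos hβ
  have hlog3 : 0 < Real.log 3 := Real.log_pos (by norm_num)
  have hbound : ∀ n : ℕ, dimH (survivor β (limitPoint β s)) ≤
      ENNReal.ofReal (Real.log 3 / Real.log β * (1 / ((n : ℝ) + 1))) := fun n => by
    refine (dimH_survivor_limitPoint_le hβ hβ2 hA H n).trans (ENNReal.ofReal_le_ofReal ?_)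
    have h1 : (n : ℝ) + 1 ≤ (bullet s n).length := by exact_mod_cast H.length_bullet n
    rw [Real.log_pow, div_mul_div_comm, mul_one, mul_comm (Real.log β)]
    gcongr
  have hl : Tendsto (fun n : ℕ => ENNReal.ofReal (Real.log 3 / Real.log β * (1 / ((n : ℝ) + 1))))
      atTop (𝓝 0) := by
    have := (tendsto_one_div_add_atTop_nhds_zero_nat (𝕜 := ℝ)).const_mul
      (Real.log 3 / Real.log β)
    rw [mul_zero] at this
    simpa using ENNReal.tendsto_ofReal this
  exact le_antisymm (ge_of_tendsto' hl hbound) zero_le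

lemma dimH_survivor_ne_zero {t : ℝ} (ht : t < limitPoint β s) : dimH (survivor β t) ≠ 0 := by
  have h0 : 0 < β := by linarith
  obtain ⟨n, hn⟩ := ((tendsto_lowerPoint hβ hA H).eventually (lt_mem_nhds ht)).exists
  have hl := H.lyndon n
  have hg := H.factor (n + 1)
  set N := (bullet s n).length with hN
  set M := (s (n + 1)).length with hM
  -- Every image under Φ_{S_n} has its tails above S_n⁻𝕃(S_n)^∞, hence above t. Spacing the free
  -- digits by M + 1 keeps the code below 𝕃(s_{n+1})^∞, so the images stay admissible.
  set c : BinSeq → BinSeq := fun e => inflateWord (bullet s n) (consSeq false (spread M e)) with hc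
  have hgM : periodic (maxRotation (s (n + 1))) M = true := by
    have := hg.b_per 0
    rwa [zero_add, hg.b_first] at this
  have hadm : ∀ e, Admissible β (c e) := fun e => by
    refine (hA.admissible_iff hβ _).2 (H.shift_inflateWord_lt n fun m hm => ?_)
    refine lt_of_lt_of_le ?_ (H.mem (n + 1)).1
    rw [H.maxRotation_succ, ← consSeq_shift_succ _ m, hm, shift_succ_consSeq]
    exact hl.inflate_cons_lt_iff.2 (shift_spread_lt hg.b_first hgM hg.pos.ne' e m)
  have hlow : ∀ e k, lowerPoint β s n ≤ proj β (shift k (c e)) := fun e k =>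
    (admissible_lowerWord hβ hA H n).proj_le hβ (hl.lowerSeq_le_shift _ k)
  have hsub : range (fun e => proj β (c e)) ⊆ survivor β t := by
    rintro _ ⟨e, rfl⟩
    exact (mem_survivor_iff hβ hβ2).2 ⟨c e, hadm e, rfl, fun k => hn.le.trans (hlow e k)⟩
  have hdim : dimH (range fun e => proj β (c e)) ≠ 0 := by
    -- The code digit m appears as digit N * ((M + 1) * m + 1) - 1 of `c e`. Behind it one tail
    -- projects to at least `lowerPoint β s n` and the other to less than 1, which yields the
    -- constant.
    refine dimH_range_ne_zero (C := lowerPoint β s n / β ^ N) (D := β ^ (N * (M + 1)))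
      (div_pos (lowerPoint_pos hβ H n) (by positivity))
      (one_lt_pow₀ hβ (Nat.mul_pos hl.pos (Nat.succ_pos M)).ne') ?_
    intro m e e' h1 h2 h3
    have hspread := spread_agree (M := M) h1
    have hcons : ∀ i < (M + 1) * m + 1,
        consSeq false (spread M e) i = consSeq false (spread M e') i := fun i hi => by
      cases i with
      | zero => rfl
      | succ i => exact hspread i (by omega)
    have hpos : 0 < N * ((M + 1) * m + 1) := Nat.mul_pos hl.pos (Nat.succ_pos _)
    have hsucc : N * ((M + 1) * m + 1) - 1 + 1 = N * ((M + 1) * m + 1) :=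
      Nat.sub_add_cancel hpos
    have hdigit : ∀ e, c e (N * ((M + 1) * m + 1) - 1) = e m := fun e => by
      rw [hc]
      dsimp only
      rw [inflateWord, inflate_of_eq hl.pos _ _ _ hsucc, consSeq_succ, spread_mul]
    have hdiff := proj_sub_eq hβ (c := c e) (d := c e') (n := N * ((M + 1) * m + 1) - 1)
      (fun i hi => inflate_agree hcons (by change i + 1 < N * _; omega)) (by rw [hdigit, h2]) (by rw [hdigit, h3])
    rw [hdiff, hsucc, div_div, ← pow_mul, ← pow_add,
      show N + N * (M + 1) * m = N * ((M + 1) * m + 1) by ring]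
    gcongr
    have a1 := hlow e' (N * ((M + 1) * m + 1))
    have a2 := hadm e (N * ((M + 1) * m + 1))
    linarith
  intro hz
  exact hdim (le_antisymm ((dimH_mono hsub).trans hz.le) zero_le)

lemma isLeast_limitPoint : IsLeast (zeroDimHoles β) (limitPoint β s) :=
  ⟨⟨(lowerPoint_pos hβ H 0).trans_le (lowerPoint_le hβ hA H 0),
    dimH_survivor_limitPoint hβ hβ2 hA H⟩, fun t ht => by
    by_contra hlt
    exact dimH_survivor_ne_zero hβ hβ2 hA H (not_le.1 hlt) ht.2⟩

end main

end BetaHole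

open BetaHole
theorem proposition10p2 (β : ℝ) (hβ : β ∈ infRenormalizable) :
    (∃! s : ℕ → Word, IsFareySequence β s) ∧
    ∀ s : ℕ → Word, IsFareySequence β s →
      IsLeast (zeroDimHoles β) (tau β) ∧
      Tendsto (fun n : ℕ => proj β (withZeros (bullet s n))) atTop (𝓝 (tau β)) ∧
      (bifurcationSet β ∩ Ioo (tau β) 1).Countable ∧
      (bifurcationSet β ∩ Ioo (tau β) 1).Infinite ∧
      ∃ t : ℕ → ℝ, StrictAnti t ∧
        (∀ n, IsGreedy β (t n) (periodic (bullet s n))) ∧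
        bifurcationSet β ∩ Ioo (tau β) 1 = Set.range t := by
  refine ⟨existsUnique_fareySequence hβ, fun s hs => ?_⟩
  obtain ⟨h1, h2⟩ := mem_Ioc_of_mem_lyndonInterval (hs.2 0)
  obtain ⟨A, hA⟩ := exists_quasiGreedyTails h1 h2
  have H : Renormalizable s A :=
    ⟨hs.1, fun n => inLyndon_of_mem (isLyndon_bullet hs.1 n) (hs.2 n) hA⟩
  have hleast := isLeast_limitPoint h1 h2 hA H
  have hanti := strictAnti_bulletPoint h1 hA H
  have hset := bifurcationSet_inter_eq h1 h2 hA H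
  have htau : tau β = limitPoint β s := hleast.csInf_eq
  rw [htau, hset]
  exact ⟨hleast, tendsto_withZeros h1 hA H, countable_range _,
    infinite_range_of_injective hanti.injective, bulletPoint β s, hanti,
    fun n => (admissible_periodic h1 hA H n).isGreedy h1, rfl⟩
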